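/- Let $A$ be a semisimple weak Hopf algebra over $\mathbb{C}$ with comultiplication $\Delta$, counit $\epsilon$ and antipode $S$; write $\Delta(1)=1_{(1)}\otimes 1_{(2)}$, and let $A_t=\{\epsilon(1_{(1)}h)1_{(2)} : h\in A\}$ and $A_s=\{1_{(1)}\epsilon(h1_{(2)}) : h\in A\}$ be its target and source bases. Assume that $A$ is regular, i.e. $S^2$ is the identity on the subalgebra generated by $A_s$ and $A_t$, and that $A$ is biconnected, i.e. $Z(A)\cap A_t=\mathbb{C}1$ and likewise $Z(A^*)\cap (A^*)_t=\mathbb{C}\epsilon$ for the dual weak Hopf algebra $A^*$. Let $G\in A$ be a pivotal element, i.e. an invertible element with $\Delta(G)=(G\otimes G)\Delta(1)=\Delta(1)(G\otimes G)$ and $S^2(h)=GhG^{-1}$ for all $h\in A$. Let $V_1,\dots,V_n$ be the irreducible $A$-modules and $W_1,\dots,W_l$ the irreducible $A_s$-modules, each listed once up to isomorphism. Let $\Lambda=(\Lambda_{\alpha j})$ be the $l\times n$ inclusion matrix of $A_s\subset A$, where $\Lambda_{\alpha j}$ is the multiplicity of $W_\alpha$ in the restriction of $V_j$ to $A_s$.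 Let $\vec d=(\dim(V_j))_{j=1}^n$ be the vector of quantum dimensions with respect to $G$: $\dim(V)\in\mathbb{C}$ is the scalar by which the endomorphism $d_{V^*}\circ(i_V\otimes\mathrm{id}_{V^*})\circ b_V$ of the unit object $A_t$ of $\mathrm{Rep}(A)$ acts, where $b$ and $d$ are the coevaluation and evaluation morphisms and $i_V:V\to V^{**}$ is the action of $G$ on $V$ followed by the canonical map $V\to V^{**}$. If $\Lambda\vec d\neq\vec 0$, then $G$ is a trivial group-like element, i.e. $G=yS(y)^{-1}$ for some invertible $y\in A_s$. In particular, $G$ is a trivial group-like element whenever all the quantum dimensions $\dim(V_1),\dots,\dim(V_n)$ are non-negative real numbers. -/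

import Mathlib

universe u

open scoped TensorProduct

/-- A weak Hopf algebra over a field `k`: an algebra and a coalgebra whose comultiplication is
multiplicative (but need not preserve the unit), with the weakened unit and counit axioms and
an antipode. -/
class WeakHopfAlgebra (k : Type*) (A : Type*) [Field k] [Ring A] [Algebra k A] extends
    Coalgebra k A where
  /-- `Δ(gh) = Δ(g)Δ(h)` -/
  comul_mul : ∀ g h : A, comul (g * h) = comul g * comul h
  /-- `(Δ ⊗ id)Δ(1) = (Δ(1) ⊗ 1)(1 ⊗ Δ(1))` -/
  comul_one_left :
    comul.rTensor A (comul 1) =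
      (comul 1 ⊗ₜ[k] (1 : A)) * (TensorProduct.assoc k A A A).symm ((1 : A) ⊗ₜ[k] comul 1)
  /-- `(Δ ⊗ id)Δ(1) = (1 ⊗ Δ(1))(Δ(1) ⊗ 1)` -/
  comul_one_right :
    comul.rTensor A (comul 1) =
      (TensorProduct.assoc k A A A).symm ((1 : A) ⊗ₜ[k] comul 1) * (comul 1 ⊗ₜ[k] (1 : A))
  /-- `ε(fgh) = ε(f g₁) ε(g₂ h)` -/
  counit_mul_left : ∀ f g h : A,
    counit (f * g * h) = LinearMap.mul' k k
      (TensorProduct.map (counit ∘ₗ LinearMap.mulLeft k f) (counit ∘ₗ LinearMap.mulRight k h)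
        (comul g))
  /-- `ε(fgh) = ε(f g₂) ε(g₁ h)` -/
  counit_mul_right : ∀ f g h : A,
    counit (f * g * h) = LinearMap.mul' k k
      (TensorProduct.map (counit ∘ₗ LinearMap.mulRight k h) (counit ∘ₗ LinearMap.mulLeft k f)
        (comul g))
  /-- the antipode `S` -/
  antipode : A →ₗ[k] A
  /-- `m(id ⊗ S)Δ(h) = (ε ⊗ id)(Δ(1)(h ⊗ 1))` -/
  mul_antipode_right : ∀ h : A,
    LinearMap.mul' k A (antipode.lTensor A (comul h)) =
      TensorProduct.lid k A (counit.rTensor A (comul 1 * (h ⊗ₜ[k] (1 : A))))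
  /-- `m(S ⊗ id)Δ(h) = (id ⊗ ε)((1 ⊗ h)Δ(1))` -/
  mul_antipode_left : ∀ h : A,
    LinearMap.mul' k A (antipode.rTensor A (comul h)) =
      TensorProduct.rid k A (counit.lTensor A (((1 : A) ⊗ₜ[k] h) * comul 1))
  /-- `S(h) = S(h₁) h₂ S(h₃)` -/
  antipode_eq : ∀ h : A,
    antipode h = LinearMap.mul' k A (TensorProduct.map
      (LinearMap.mul' k A ∘ₗ antipode.rTensor A) antipode (comul.rTensor A (comul h)))

namespace WeakHopf

open Coalgebra

section General

variable (k : Type*) (A : Type*) [Field k] [Ring A] [Algebra k A] [WeakHopfAlgebra k A]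

/-- The antipode of `A`. -/
def S : A →ₗ[k] A := WeakHopfAlgebra.antipode

/-- The target counital map `ε_t(h) = ε(1₁ h) 1₂`. -/
def targetMap : A →ₗ[k] A :=
  (TensorProduct.lid k A).toLinearMap ∘ₗ (counit (R := k) (A := A)).rTensor A ∘ₗ
    LinearMap.mulLeft k (comul (R := k) (1 : A)) ∘ₗ (TensorProduct.mk k A A).flip 1

/-- The source counital map `ε_s(h) = 1₁ ε(h 1₂)`. -/
def sourceMap : A →ₗ[k] A :=
  (TensorProduct.rid k A).toLinearMap ∘ₗ (counit (R := k) (A := A)).lTensor A ∘ₗ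
    LinearMap.mulRight k (comul (R := k) (1 : A)) ∘ₗ TensorProduct.mk k A A 1

variable {k A}

/-- The slice `(φ ⊗ id)(t)` of a tensor `t`. -/
def sliceLeft (φ : A →ₗ[k] k) : A ⊗[k] A →ₗ[k] A :=
  (TensorProduct.lid k A).toLinearMap ∘ₗ φ.rTensor A

/-- The slice `(id ⊗ φ)(t)` of a tensor `t`. -/
def sliceRight (φ : A →ₗ[k] k) : A ⊗[k] A →ₗ[k] A :=
  (TensorProduct.rid k A).toLinearMap ∘ₗ φ.lTensor A

theorem targetMap_eq_slice (h : A) :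
    targetMap k A h =
      sliceLeft ((counit (R := k) (A := A)) ∘ₗ LinearMap.mulRight k h) (comul (R := k) 1) := by
  have key : ∀ t : A ⊗[k] A,
      TensorProduct.lid k A ((counit (R := k) (A := A)).rTensor A (t * (h ⊗ₜ[k] (1 : A)))) =
      sliceLeft ((counit (R := k) (A := A)) ∘ₗ LinearMap.mulRight k h) t := by
    intro t
    induction t using TensorProduct.induction_on with
    | zero => simp
    | tmul a b => simp [sliceLeft]
    | add x y hx hy => simp only [add_mul, map_add, hx, hy]
  exact key _

theorem sourceMap_eq_slice (h : A) :
    sourceMap k A h =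
      sliceRight ((counit (R := k) (A := A)) ∘ₗ LinearMap.mulLeft k h) (comul (R := k) 1) := by
  have key : ∀ t : A ⊗[k] A,
      TensorProduct.rid k A ((counit (R := k) (A := A)).lTensor A (((1 : A) ⊗ₜ[k] h) * t)) =
      sliceRight ((counit (R := k) (A := A)) ∘ₗ LinearMap.mulLeft k h) t := by
    intro t
    induction t using TensorProduct.induction_on with
    | zero => simp
    | tmul a b => simp [sliceRight]
    | add x y hx hy => simp only [mul_add, map_add, hx, hy]
  exact key _

theorem comul_sliceLeft (φ : A →ₗ[k] k) :
    comul (R := k) (sliceLeft φ (comul (R := k) (1 : A))) =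
      comul (R := k) (1 : A) * (sliceLeft φ (comul (R := k) (1 : A)) ⊗ₜ[k] (1 : A)) := by
  have h1 : ∀ t : A ⊗[k] A, comul (R := k) (sliceLeft φ t) =
      TensorProduct.lid k (A ⊗[k] A) (φ.rTensor (A ⊗[k] A)
        ((comul (R := k) (A := A)).lTensor A t)) := by
    intro t
    induction t using TensorProduct.induction_on with
    | zero => simp
    | tmul a b => simp [sliceLeft]
    | add x y hx hy => simp only [map_add, hx, hy]
  have h2 : ∀ s t : A ⊗[k] A, TensorProduct.lid k (A ⊗[k] A) (φ.rTensor (A ⊗[k] A)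
      (TensorProduct.assoc k A A A
        ((TensorProduct.assoc k A A A).symm ((1 : A) ⊗ₜ[k] s) * (t ⊗ₜ[k] (1 : A))))) =
      s * (sliceLeft φ t ⊗ₜ[k] (1 : A)) := by
    intro s t
    induction s using TensorProduct.induction_on with
    | zero => simp
    | add x y hx hy => simp only [TensorProduct.tmul_add, map_add, add_mul, hx, hy]
    | tmul a b =>
      induction t using TensorProduct.induction_on with
      | zero => simp
      | tmul c d => simp [sliceLeft, TensorProduct.smul_tmul']
      | add x y hx hy => simp only [TensorProduct.add_tmul, map_add, mul_add, hx, hy]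
  rw [h1, ← Coalgebra.coassoc_apply, WeakHopfAlgebra.comul_one_right, h2]

theorem comul_sliceRight (φ : A →ₗ[k] k) :
    comul (R := k) (sliceRight φ (comul (R := k) (1 : A))) =
      ((1 : A) ⊗ₜ[k] sliceRight φ (comul (R := k) (1 : A))) * comul (R := k) (1 : A) := by
  have h1 : ∀ t : A ⊗[k] A, comul (R := k) (sliceRight φ t) =
      TensorProduct.rid k (A ⊗[k] A) (φ.lTensor (A ⊗[k] A)
        ((comul (R := k) (A := A)).rTensor A t)) := by
    intro t
    induction t using TensorProduct.induction_on with
    | zero => simp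
    | tmul a b => simp [sliceRight]
    | add x y hx hy => simp only [map_add, hx, hy]
  have h2 : ∀ s t : A ⊗[k] A, TensorProduct.rid k (A ⊗[k] A) (φ.lTensor (A ⊗[k] A)
        ((TensorProduct.assoc k A A A).symm ((1 : A) ⊗ₜ[k] s) * (t ⊗ₜ[k] (1 : A)))) =
      ((1 : A) ⊗ₜ[k] sliceRight φ s) * t := by
    intro s t
    induction s using TensorProduct.induction_on with
    | zero => simp
    | add x y hx hy => simp only [TensorProduct.tmul_add, map_add, add_mul, hx, hy]
    | tmul a b =>
      induction t using TensorProduct.induction_on with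
      | zero => simp
      | tmul c d => simp [sliceRight]
      | add x y hx hy => simp only [TensorProduct.add_tmul, map_add, mul_add, hx, hy]
  rw [h1, WeakHopfAlgebra.comul_one_right, h2]

theorem targetMap_of_comul {h : A}
    (hh : comul (R := k) h = comul (R := k) (1 : A) * (h ⊗ₜ[k] (1 : A))) :
    targetMap k A h = h := by
  change TensorProduct.lid k A ((counit (R := k) (A := A)).rTensor A
    (comul (R := k) (1 : A) * (h ⊗ₜ[k] (1 : A)))) = h
  rw [← hh, Coalgebra.rTensor_counit_comul]
  simp

theorem sourceMap_of_comul {h : A}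
    (hh : comul (R := k) h = ((1 : A) ⊗ₜ[k] h) * comul (R := k) (1 : A)) :
    sourceMap k A h = h := by
  change TensorProduct.rid k A ((counit (R := k) (A := A)).lTensor A
    (((1 : A) ⊗ₜ[k] h) * comul (R := k) (1 : A))) = h
  rw [← hh, Coalgebra.lTensor_counit_comul]
  simp

theorem mem_range_targetMap {h : A} : h ∈ LinearMap.range (targetMap k A) ↔
    comul (R := k) h = comul (R := k) (1 : A) * (h ⊗ₜ[k] (1 : A)) := by
  constructor
  · rintro ⟨x, rfl⟩
    rw [targetMap_eq_slice, comul_sliceLeft]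
  · exact fun hh => ⟨h, targetMap_of_comul hh⟩

theorem mem_range_sourceMap {h : A} : h ∈ LinearMap.range (sourceMap k A) ↔
    comul (R := k) h = ((1 : A) ⊗ₜ[k] h) * comul (R := k) (1 : A) := by
  constructor
  · rintro ⟨x, rfl⟩
    rw [sourceMap_eq_slice, comul_sliceRight]
  · exact fun hh => ⟨h, sourceMap_of_comul hh⟩

theorem sliceLeft_mem (φ : A →ₗ[k] k) :
    sliceLeft φ (comul (R := k) (1 : A)) ∈ LinearMap.range (targetMap k A) :=
  mem_range_targetMap.2 (comul_sliceLeft φ)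

variable (k A)

/-- The target base `A_t = ε_t(A)`, a subalgebra of `A`. -/
def targetBase : Subalgebra k A where
  carrier := LinearMap.range (targetMap k A)
  add_mem' := fun ha hb => add_mem (S := Submodule k A) ha hb
  mul_mem' := by
    intro a b ha hb
    have ha' := mem_range_targetMap.1 ha
    have hb' := mem_range_targetMap.1 hb
    refine mem_range_targetMap.2 ?_
    rw [WeakHopfAlgebra.comul_mul, hb', ← mul_assoc, ← WeakHopfAlgebra.comul_mul, mul_one, ha',
      mul_assoc, Algebra.TensorProduct.tmul_mul_tmul, mul_one]
  algebraMap_mem' := by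
    intro r
    refine mem_range_targetMap.2 ?_
    rw [Algebra.algebraMap_eq_smul_one, map_smul, ← TensorProduct.smul_tmul', mul_smul_comm,
      ← Algebra.TensorProduct.one_def, mul_one]

/-- The source base `A_s = ε_s(A)`, a subalgebra of `A`. -/
def sourceBase : Subalgebra k A where
  carrier := LinearMap.range (sourceMap k A)
  add_mem' := fun ha hb => add_mem (S := Submodule k A) ha hb
  mul_mem' := by
    intro a b ha hb
    have ha' := mem_range_sourceMap.1 ha
    have hb' := mem_range_sourceMap.1 hb
    refine mem_range_sourceMap.2 ?_
    rw [WeakHopfAlgebra.comul_mul, ha', mul_assoc, ← WeakHopfAlgebra.comul_mul, one_mul, hb',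
      ← mul_assoc, Algebra.TensorProduct.tmul_mul_tmul, mul_one]
  algebraMap_mem' := by
    intro r
    refine mem_range_sourceMap.2 ?_
    rw [Algebra.algebraMap_eq_smul_one, map_smul, TensorProduct.tmul_smul, smul_mul_assoc,
      ← Algebra.TensorProduct.one_def, one_mul]

/-- The minimal weak Hopf subalgebra: the subalgebra generated by `A_s` and `A_t`. -/
def minimalSubalgebra : Subalgebra k A := sourceBase k A ⊔ targetBase k A

/-- `A` is regular if `S²` is the identity on the minimal weak Hopf subalgebra. -/
def IsRegular : Prop := ∀ x ∈ minimalSubalgebra k A, S k A (S k A x) = x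

/-- `A` is connected if `Z(A) ∩ A_t = k1`. -/
def IsConnected : Prop := Subalgebra.center k A ⊓ targetBase k A = ⊥

/-- The product `⟨φψ, h⟩ = ⟨φ ⊗ ψ, Δ(h)⟩` of the dual weak Hopf algebra `A*`. -/
def dualMul (φ ψ : A →ₗ[k] k) : A →ₗ[k] k :=
  LinearMap.mul' k k ∘ₗ TensorProduct.map φ ψ ∘ₗ comul

/-- The target counital map of the dual weak Hopf algebra `A*`. Since the unit of `A*` is `ε`,
its comultiplication is `⟨Δ(ε), g ⊗ h⟩ = ε(gh)`, and its counit is evaluation at `1`, this is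
`⟨ε_t(φ), h⟩ = ⟨ε₁φ, 1⟩⟨ε₂, h⟩ = ε(1₁h)⟨φ, 1₂⟩`. -/
def dualTargetMap (φ : A →ₗ[k] k) : A →ₗ[k] k :=
  LinearMap.mul' k k ∘ₗ TensorProduct.map counit φ ∘ₗ
    LinearMap.mulLeft k (comul (R := k) (1 : A)) ∘ₗ (TensorProduct.mk k A A).flip 1

/-- `A` is coconnected if the dual weak Hopf algebra is connected, i.e. `Z(A*) ∩ A*_t = kε`. -/
def IsCoconnected : Prop :=
  ∀ φ : A →ₗ[k] k, (∃ ψ, φ = dualTargetMap k A ψ) →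
    (∀ ψ, dualMul k A φ ψ = dualMul k A ψ φ) → ∃ c : k, φ = c • counit

variable {A}

/-- `g` is group-like: it is invertible and `Δ(g) = (g ⊗ g)Δ(1) = Δ(1)(g ⊗ g)`. -/
def IsGroupLike (g : Aˣ) : Prop :=
  comul (R := k) (g : A) = ((g : A) ⊗ₜ[k] (g : A)) * comul (R := k) (1 : A) ∧
    comul (R := k) (g : A) = comul (R := k) (1 : A) * ((g : A) ⊗ₜ[k] (g : A))

/-- `G` is a pivotal element: it is group-like and `S²(h) = G h G⁻¹` for all `h`. -/
def IsPivotalElement (G : Aˣ) : Prop :=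
  IsGroupLike k G ∧ ∀ h : A, S k A (S k A h) = G * h * (G⁻¹ : Aˣ)

/-- `g` is a trivial group-like element: `g = y S(y)⁻¹` for some (invertible) `y ∈ A_s`. -/
def IsTrivialGroupLike (g : Aˣ) : Prop :=
  ∃ y s : Aˣ, (y : A) ∈ sourceBase k A ∧ (s : A) = S k A y ∧ g = y * s⁻¹

end General

section QuantumDimension

/-! Modules are handled here through their action maps `ρ : A → End_k(V)`. -/

variable {k : Type*} {A : Type*} [Field k] [Ring A] [Algebra k A] [WeakHopfAlgebra k A]
variable {V W : Type*} [AddCommGroup V] [Module k V] [AddCommGroup W] [Module k W]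

/-- The action on the dual module `V* = Hom_k(V, k)`: `⟨h·φ, v⟩ = ⟨φ, S(h)·v⟩`. -/
def dualAction (ρ : A →ₗ[k] Module.End k V) : A →ₗ[k] Module.End k (Module.Dual k V) :=
  Module.Dual.transpose ∘ₗ ρ ∘ₗ S k A

/-- The action of `A` on `V ⊗_k W` through `Δ`; the tensor product `V ⊠ W` of the representation
category is the subspace `Δ(1)·(V ⊗_k W)`. -/
def tensorAction (ρ : A →ₗ[k] Module.End k V) (σ : A →ₗ[k] Module.End k W) :
    A →ₗ[k] Module.End k (V ⊗[k] W) :=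
  TensorProduct.homTensorHomMap (.id k) V W V W ∘ₗ TensorProduct.map ρ σ ∘ₗ comul

/-- The `A`-valued map `φ ⊗ v ↦ φ(1₁·v) 1₂`. -/
def evalAux (ρ : A →ₗ[k] Module.End k V) : Module.Dual k V ⊗[k] V →ₗ[k] A :=
  TensorProduct.lift (LinearMap.mk₂ k
    (fun φ v => sliceLeft (φ ∘ₗ LinearMap.applyₗ v ∘ₗ ρ) (comul (R := k) (1 : A)))
    (by intros; simp [sliceLeft, LinearMap.add_comp, LinearMap.rTensor_add])
    (by intros; simp [sliceLeft, LinearMap.smul_comp, LinearMap.rTensor_smul])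
    (by intros; simp [sliceLeft, LinearMap.add_comp, LinearMap.comp_add, LinearMap.rTensor_add])
    (by intros; simp [sliceLeft, LinearMap.smul_comp, LinearMap.comp_smul,
          LinearMap.rTensor_smul]))

theorem evalAux_mem (ρ : A →ₗ[k] Module.End k V) (x : Module.Dual k V ⊗[k] V) :
    evalAux ρ x ∈ targetBase k A := by
  induction x using TensorProduct.induction_on with
  | zero => simp
  | tmul φ v => exact sliceLeft_mem _
  | add x y hx hy => rw [map_add]; exact add_mem hx hy

/-- The evaluation `d_V : V* ⊠ V → A_t`, `φ ⊗ v ↦ φ(1₁·v) 1₂`, given by the same formula on all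
of `V* ⊗_k V`. -/
def evaluation (ρ : A →ₗ[k] Module.End k V) : Module.Dual k V ⊗[k] V →ₗ[k] targetBase k A :=
  (evalAux ρ).codRestrict (Subalgebra.toSubmodule (targetBase k A)) (evalAux_mem ρ)

/-- The coevaluation `b_V : A_t → V ⊠ V*`, `z ↦ z·(∑ᵢ fᵢ ⊗ ξⁱ)`, for dual bases `fᵢ`, `ξⁱ`. -/
noncomputable def coevaluation [FiniteDimensional k V] (ρ : A →ₗ[k] Module.End k V) :
    targetBase k A →ₗ[k] V ⊗[k] Module.Dual k V :=
  LinearMap.applyₗ (_root_.coevaluation k V 1) ∘ₗ tensorAction ρ (dualAction ρ) ∘ₗ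
    (targetBase k A).val.toLinearMap

/-- The isomorphism `V → V**` given by the action of a pivotal element `G` followed by the
canonical map. -/
def pivotalMap (G : Aˣ) (ρ : A →ₗ[k] Module.End k V) :
    V →ₗ[k] Module.Dual k (Module.Dual k V) :=
  Module.Dual.eval k V ∘ₗ ρ (G : A)

/-- The endomorphism `d_{V*} ∘ (i ⊗ id_{V*}) ∘ b_V` of the unit object `A_t`, where `i` is the
pivotal structure given by `G`. -/
noncomputable def quantumTrace [FiniteDimensional k V] (G : Aˣ) (ρ : A →ₗ[k] Module.End k V) :
    targetBase k A →ₗ[k] targetBase k A :=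
  evaluation (dualAction ρ) ∘ₗ (pivotalMap G ρ).rTensor (Module.Dual k V) ∘ₗ coevaluation ρ

variable (k V) in
/-- The quantum dimension of a finite-dimensional `A`-module `V` with respect to `G`. For connected
`A` the endomorphism `quantumTrace` of the simple unit object `A_t` is a scalar multiple of the
identity; that scalar is read off as the trace divided by `dim A_t`. -/
noncomputable def quantumDim [Module A V] [IsScalarTower k A V] [FiniteDimensional k V]
    (G : Aˣ) : k :=
  LinearMap.trace k (targetBase k A) (quantumTrace G (Algebra.lsmul k k V).toLinearMap) /
    (Module.finrank k (targetBase k A) : k)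

end QuantumDimension

section Simple

/-- `V` lists the irreducible `R`-modules up to isomorphism, each exactly once. -/
structure IsSimpleList (R : Type u) [Ring R] {ι : Type*} (V : ι → Type u)
    [∀ i, AddCommGroup (V i)] [∀ i, Module R (V i)] : Prop where
  simple : ∀ i, IsSimpleModule R (V i)
  irredundant : ∀ i j, Nonempty (V i ≃ₗ[R] V j) → i = j
  complete : ∀ (M : Type u) [AddCommGroup M] [Module R M], IsSimpleModule R M →
    ∃ i, Nonempty (M ≃ₗ[R] V i)

/-- The inclusion matrix `Λ` of `A_s ⊂ A`: `Λ α j` is the multiplicity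
`dim Hom_{A_s}(W α, V j)` of the irreducible `A_s`-module `W α` in the restriction of the
`A`-module `V j` to `A_s`. -/
noncomputable def inclusionMatrix (k : Type*) {A : Type*} [Field k] [Ring A] [Algebra k A]
    [WeakHopfAlgebra k A] {ι κ : Type*} (V : ι → Type*) [∀ j, AddCommGroup (V j)]
    [∀ j, Module k (V j)] [∀ j, Module A (V j)] [∀ j, IsScalarTower k A (V j)]
    (W : κ → Type*) [∀ a, AddCommGroup (W a)] [∀ a, Module (sourceBase k A) (W a)] :
    Matrix κ ι ℕ :=
  Matrix.of fun a j => Module.finrank k (W a →ₗ[sourceBase k A] V j)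

end Simple

end WeakHopf

namespace WeakHopf

open Coalgebra

/-! ### Counital maps, and the commuting source and target bases. -/

section Basic

variable {k : Type*} {A : Type*} [Field k] [Ring A] [Algebra k A] [WeakHopfAlgebra k A]

/-! Everything rests on the functional θ(x) = Tr_A(y ↦ x y G) and its slice z = θ(1₁)1₂ in A_t.
Taking partial traces of two composites of coproduct-type operators A → A ⊗ A, whose
End(A)-coefficients differ only by order of composition, gives zG = S(z)
(`sliceLeft_pivotalFunctional_mul`).

If z ≠ 0, this forces triviality (`isTrivialGroupLike_of_mul_eq`). The element w = S(z) is central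
in A_s, which is semisimple by regularity. The idempotent e generating the ideal of w satisfies e =
S(e), so it lies in A_s ∩ A_t, which is ℂ1 because the dual is connected. Hence e = 1, w is
invertible, and S(w) = z = wG⁻¹ gives G = wS(w)⁻¹.

It remains to see that z ≠ 0. For s in A_s, θ(s) = ε(sz), while decomposing A into matrix blocks
gives θ(s) = ∑ⱼ χⱼ(s)χⱼ(G) (`pivotalFunctional_eq`). Here χⱼ(G) = dim(A_t)·dim(Vⱼ)
(`quantumDim_eq`), and Λ_{αj} = χⱼ(p) for an idempotent p in A_s generating a copy of W_α
(`exists_character_eq_finrank`). So θ(p) = dim(A_t)·(Λd)_α, and Λd ≠ 0 makes z nonzero.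

For non-negative dimensions no cancellation can occur in Λd, so one positive term is enough. It
comes from an irreducible summand of the unit object, on which G acts as the identity
(`exists_pivotal_smul_eq`). -/

theorem comul_one_mul (x : A) : comul (R := k) (1 : A) * comul x = comul x := by
  rw [← WeakHopfAlgebra.comul_mul, one_mul]

theorem comul_mul_one (x : A) : comul (R := k) x * comul (1 : A) = comul x := by
  rw [← WeakHopfAlgebra.comul_mul, mul_one]

theorem targetMap_apply (h : A) : targetMap k A h =
    TensorProduct.lid k A (counit.rTensor A (comul 1 * (h ⊗ₜ[k] (1 : A)))) := rfl

/-- `x₁ ⊗ ε_t(x₂) = Δ(1)(x ⊗ 1)`. -/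
theorem lTensor_targetMap_comul (x : A) :
    (targetMap k A).lTensor A (comul x) = comul (R := k) (1 : A) * (x ⊗ₜ[k] (1 : A)) := by
  have h1 : ∀ t : A ⊗[k] A, comul.rTensor A t * (comul (R := k) x ⊗ₜ[k] (1 : A)) =
      comul.rTensor A (t * (x ⊗ₜ[k] (1 : A))) := by
    intro t
    induction t using TensorProduct.induction_on with
    | zero => simp
    | tmul a b => simp [WeakHopfAlgebra.comul_mul]
    | add s t hs ht => simp only [map_add, add_mul, hs, ht]
  have h2 : ∀ t : A ⊗[k] A, ((TensorProduct.rid k A).toLinearMap ∘ₗ counit.lTensor A).rTensor A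
      (comul.rTensor A t) = t := by
    intro t
    induction t using TensorProduct.induction_on with
    | zero => simp
    | tmul a b => simp [Coalgebra.lTensor_counit_comul]
    | add s t hs ht => simp only [map_add, hs, ht]
  have h3 : ∀ s t : A ⊗[k] A,
      ((TensorProduct.rid k A).toLinearMap ∘ₗ counit.lTensor A).rTensor A
        ((TensorProduct.assoc k A A A).symm ((1 : A) ⊗ₜ[k] s) * (t ⊗ₜ[k] (1 : A))) =
      ((TensorProduct.lid k A).toLinearMap ∘ₗ (counit (R := k) (A := A)).rTensor A ∘ₗ
        LinearMap.mulLeft k s ∘ₗ (TensorProduct.mk k A A).flip 1).lTensor A t := by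
    intro s t
    induction t using TensorProduct.induction_on with
    | zero => simp
    | add x y hx hy => simp only [TensorProduct.add_tmul, mul_add, map_add, hx, hy]
    | tmul c d =>
      induction s using TensorProduct.induction_on with
      | zero => simp
      | add x y hx hy =>
        simp only [TensorProduct.tmul_add, map_add, add_mul, hx, hy]
        simp [add_mul, TensorProduct.tmul_add]
      | tmul a b => simp [TensorProduct.smul_tmul']
  -- Multiply the axiom for (Δ ⊗ id)Δ(1) by Δ(x) ⊗ 1 and apply ε to the middle leg: one side
  -- collapses to Δ(1)(x ⊗ 1), the other becomes x₁ ⊗ ε(1₁x₂)1₂.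
  have h4 := congrArg (fun t => ((TensorProduct.rid k A).toLinearMap ∘ₗ
    counit.lTensor A).rTensor A (t * (comul (R := k) x ⊗ₜ[k] (1 : A))))
    (WeakHopfAlgebra.comul_one_right (k := k) (A := A))
  simp only [h1, h2, mul_assoc, Algebra.TensorProduct.tmul_mul_tmul, comul_one_mul, mul_one,
    h3] at h4
  exact h4.symm

/-- `ε_s(x₁) ⊗ x₂ = (1 ⊗ x)Δ(1)`. -/
theorem rTensor_sourceMap_comul (x : A) :
    (sourceMap k A).rTensor A (comul x) = ((1 : A) ⊗ₜ[k] x) * comul (R := k) (1 : A) := by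
  have h1 : ∀ t : A ⊗[k] A, ((1 : A) ⊗ₜ[k] comul (R := k) x) * comul.lTensor A t =
      comul.lTensor A (((1 : A) ⊗ₜ[k] x) * t) := by
    intro t
    induction t using TensorProduct.induction_on with
    | zero => simp
    | tmul a b => simp [WeakHopfAlgebra.comul_mul]
    | add s t hs ht => simp only [map_add, mul_add, hs, ht]
  have h2 : ∀ t : A ⊗[k] A, ((TensorProduct.lid k A).toLinearMap ∘ₗ counit.rTensor A).lTensor A
      (comul.lTensor A t) = t := by
    intro t
    induction t using TensorProduct.induction_on with
    | zero => simp
    | tmul a b => simp [Coalgebra.rTensor_counit_comul]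
    | add s t hs ht => simp only [map_add, hs, ht]
  have h3 : ∀ s t : A ⊗[k] A,
      ((TensorProduct.lid k A).toLinearMap ∘ₗ counit.rTensor A).lTensor A
        (((1 : A) ⊗ₜ[k] t) * TensorProduct.assoc k A A A (s ⊗ₜ[k] (1 : A))) =
      ((TensorProduct.rid k A).toLinearMap ∘ₗ (counit (R := k) (A := A)).lTensor A ∘ₗ
        LinearMap.mulRight k s ∘ₗ TensorProduct.mk k A A 1).rTensor A t := by
    intro s t
    induction t using TensorProduct.induction_on with
    | zero => simp
    | add x y hx hy => simp only [TensorProduct.tmul_add, add_mul, map_add, hx, hy]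
    | tmul c d =>
      induction s using TensorProduct.induction_on with
      | zero => simp
      | add x y hx hy =>
        simp only [TensorProduct.add_tmul, map_add, mul_add, hx, hy]
        simp [mul_add, TensorProduct.add_tmul]
      | tmul a b => simp [TensorProduct.smul_tmul']
  have h5 : ∀ s t : A ⊗[k] A, TensorProduct.assoc k A A A
      ((TensorProduct.assoc k A A A).symm ((1 : A) ⊗ₜ[k] s) * (t ⊗ₜ[k] (1 : A))) =
      ((1 : A) ⊗ₜ[k] s) * TensorProduct.assoc k A A A (t ⊗ₜ[k] (1 : A)) := by
    intro s t
    induction t using TensorProduct.induction_on with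
    | zero => simp
    | add x y hx hy => simp only [TensorProduct.add_tmul, mul_add, map_add, hx, hy]
    | tmul c d =>
      induction s using TensorProduct.induction_on with
      | zero => simp
      | add x y hx hy => simp only [TensorProduct.tmul_add, map_add, add_mul, hx, hy]
      | tmul a b => simp
  have h4 := congrArg (fun t => ((TensorProduct.lid k A).toLinearMap ∘ₗ
    counit.rTensor A).lTensor A (((1 : A) ⊗ₜ[k] comul (R := k) x) * TensorProduct.assoc k A A A t))
    (WeakHopfAlgebra.comul_one_right (k := k) (A := A))
  simp only [Coalgebra.coassoc_apply, h1, h2, h5, ← mul_assoc, Algebra.TensorProduct.tmul_mul_tmul,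
    comul_mul_one, mul_one, h3] at h4
  exact h4.symm

theorem targetMap_mem (h : A) : targetMap k A h ∈ targetBase k A := ⟨h, rfl⟩

theorem sourceMap_mem (h : A) : sourceMap k A h ∈ sourceBase k A := ⟨h, rfl⟩

theorem mem_targetBase {h : A} : h ∈ targetBase k A ↔
    comul (R := k) h = comul (R := k) (1 : A) * (h ⊗ₜ[k] (1 : A)) := mem_range_targetMap

theorem mem_sourceBase {h : A} : h ∈ sourceBase k A ↔
    comul (R := k) h = ((1 : A) ⊗ₜ[k] h) * comul (R := k) (1 : A) := mem_range_sourceMap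

theorem targetMap_of_mem {h : A} (hh : h ∈ targetBase k A) : targetMap k A h = h :=
  targetMap_of_comul (mem_targetBase.1 hh)

theorem sourceMap_of_mem {h : A} (hh : h ∈ sourceBase k A) : sourceMap k A h = h :=
  sourceMap_of_comul (mem_sourceBase.1 hh)

variable (k A) in
/-- `Δ(1)` lies in `A_s ⊗ A_t`. -/
theorem exists_comul_one : ∃ (n : ℕ) (a b : Fin n → A), (∀ i, a i ∈ sourceBase k A) ∧
    (∀ i, b i ∈ targetBase k A) ∧ comul (R := k) (1 : A) = ∑ i, a i ⊗ₜ[k] b i := by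
  -- At x = 1 the two preceding identities say that Δ(1) is fixed by ε_t on its right leg and by ε_s
  -- on its left leg.
  have h1 : comul (R := k) (1 : A) = TensorProduct.map (sourceMap k A) (targetMap k A) (comul 1) := by
    have e1 := lTensor_targetMap_comul (k := k) (1 : A)
    have e2 := rTensor_sourceMap_comul (k := k) (1 : A)
    rw [← Algebra.TensorProduct.one_def, mul_one] at e1
    rw [← Algebra.TensorProduct.one_def, one_mul] at e2
    rw [← LinearMap.rTensor_comp_lTensor, LinearMap.comp_apply, e1, e2]
  let r := ℛ k (1 : A)
  let e := r.index.equivFin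
  refine ⟨r.index.card, fun i => sourceMap k A (r.left (e.symm i)),
    fun i => targetMap k A (r.right (e.symm i)), fun _ => sourceMap_mem _,
    fun _ => targetMap_mem _, ?_⟩
  rw [e.symm.sum_comp (fun i : r.index => sourceMap k A (r.left i) ⊗ₜ[k] targetMap k A (r.right i)),
    Finset.sum_coe_sort r.index (fun i => sourceMap k A (r.left i) ⊗ₜ[k] targetMap k A (r.right i)),
    h1, ← r.eq, map_sum]
  simp

/-- The source and target bases commute. -/
theorem commute_of_mem {a b : A} (ha : a ∈ sourceBase k A) (hb : b ∈ targetBase k A) :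
    a * b = b * a := by
  rw [← sourceMap_of_mem ha, ← targetMap_of_mem hb, sourceMap_eq_slice, targetMap_eq_slice]
  generalize (counit (R := k) (A := A)) ∘ₗ LinearMap.mulRight k b = φ
  generalize (counit (R := k) (A := A)) ∘ₗ LinearMap.mulLeft k a = ψ
  -- `F` contracts the outer legs and keeps the middle one. The two factorisations of (Δ ⊗ id)Δ(1)
  -- then yield the product in its two orders.
  let F : (A ⊗[k] A) ⊗[k] A →ₗ[k] A := sliceRight ψ ∘ₗ (sliceLeft φ).rTensor A
  have h1 : ∀ s t : A ⊗[k] A, F ((s ⊗ₜ[k] (1 : A)) * (TensorProduct.assoc k A A A).symm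
      ((1 : A) ⊗ₜ[k] t)) = sliceLeft φ s * sliceRight ψ t := by
    intro s t
    induction t using TensorProduct.induction_on with
    | zero => simp
    | add x y hx hy => simp only [TensorProduct.tmul_add, mul_add, map_add, hx, hy]
    | tmul c d =>
      induction s using TensorProduct.induction_on with
      | zero => simp
      | add x y hx hy => simp only [TensorProduct.add_tmul, map_add, add_mul, hx, hy]
      | tmul a b => simp [F, sliceLeft, sliceRight]
  have h2 : ∀ s t : A ⊗[k] A, F ((TensorProduct.assoc k A A A).symm
      ((1 : A) ⊗ₜ[k] t) * (s ⊗ₜ[k] (1 : A))) = sliceRight ψ t * sliceLeft φ s := by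
    intro s t
    induction t using TensorProduct.induction_on with
    | zero => simp
    | add x y hx hy => simp only [TensorProduct.tmul_add, add_mul, map_add, hx, hy]
    | tmul c d =>
      induction s using TensorProduct.induction_on with
      | zero => simp
      | add x y hx hy => simp only [TensorProduct.add_tmul, map_add, mul_add, hx, hy]
      | tmul a b => simp [F, sliceLeft, sliceRight, smul_comm (ψ d)]
  rw [← h1, ← h2, ← WeakHopfAlgebra.comul_one_left, ← WeakHopfAlgebra.comul_one_right]

theorem comul_target' {b : A} (hb : b ∈ targetBase k A) :
    comul (R := k) b = (b ⊗ₜ[k] (1 : A)) * comul (R := k) (1 : A) := by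
  obtain ⟨n, a, c, ha, hc, h⟩ := exists_comul_one k A
  rw [mem_targetBase.1 hb, h]
  simp only [Finset.sum_mul, Finset.mul_sum, Algebra.TensorProduct.tmul_mul_tmul, mul_one, one_mul,
    commute_of_mem (ha _) hb]

theorem comul_source' {a : A} (ha : a ∈ sourceBase k A) :
    comul (R := k) a = comul (R := k) (1 : A) * ((1 : A) ⊗ₜ[k] a) := by
  obtain ⟨n, c, d, hc, hd, h⟩ := exists_comul_one k A
  rw [mem_sourceBase.1 ha, h]
  simp only [Finset.sum_mul, Finset.mul_sum, Algebra.TensorProduct.tmul_mul_tmul, mul_one, one_mul,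
    commute_of_mem ha (hd _)]

theorem comul_mul_target (h : A) {b : A} (hb : b ∈ targetBase k A) :
    comul (R := k) (h * b) = comul (R := k) h * (b ⊗ₜ[k] (1 : A)) := by
  rw [WeakHopfAlgebra.comul_mul, mem_targetBase.1 hb, ← mul_assoc, comul_mul_one]

theorem comul_target_mul (h : A) {b : A} (hb : b ∈ targetBase k A) :
    comul (R := k) (b * h) = (b ⊗ₜ[k] (1 : A)) * comul (R := k) h := by
  rw [WeakHopfAlgebra.comul_mul, comul_target' hb, mul_assoc, comul_one_mul]

theorem comul_source_mul (h : A) {a : A} (ha : a ∈ sourceBase k A) :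
    comul (R := k) (a * h) = ((1 : A) ⊗ₜ[k] a) * comul (R := k) h := by
  rw [WeakHopfAlgebra.comul_mul, mem_sourceBase.1 ha, mul_assoc, comul_one_mul]

theorem counit_mul_targetMap (g h : A) :
    counit (R := k) (g * targetMap k A h) = counit (R := k) (g * h) := by
  have := WeakHopfAlgebra.counit_mul_right (k := k) g 1 h
  rw [mul_one] at this
  rw [this, targetMap_eq_slice]
  generalize comul (R := k) (1 : A) = t
  induction t using TensorProduct.induction_on with
  | zero => simp
  | tmul a b => simp [sliceLeft]
  | add x y hx hy => simp only [map_add, mul_add, hx, hy]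

theorem counit_sourceMap_mul (g h : A) :
    counit (R := k) (sourceMap k A g * h) = counit (R := k) (g * h) := by
  have := WeakHopfAlgebra.counit_mul_right (k := k) g 1 h
  rw [mul_one] at this
  rw [this, sourceMap_eq_slice]
  generalize comul (R := k) (1 : A) = t
  induction t using TensorProduct.induction_on with
  | zero => simp
  | tmul a b => simp [sliceRight, mul_comm]
  | add x y hx hy => simp only [map_add, add_mul, hx, hy]

/-- The value of ε_t at h depends only on the functional x ↦ ε(xh), which does not distinguish h
from ε_t(h). In particular ker ε_t is a left ideal. -/
theorem targetMap_mul_targetMap (g h : A) :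
    targetMap k A (g * targetMap k A h) = targetMap k A (g * h) := by
  have : (counit (R := k) (A := A)) ∘ₗ LinearMap.mulRight k (g * targetMap k A h) =
      counit ∘ₗ LinearMap.mulRight k (g * h) := LinearMap.ext fun x => by
    simp only [LinearMap.comp_apply, LinearMap.mulRight_apply, ← mul_assoc, counit_mul_targetMap]
  simp only [targetMap_eq_slice (k := k) (g * _), this]

theorem sourceMap_sourceMap_mul (g h : A) :
    sourceMap k A (sourceMap k A g * h) = sourceMap k A (g * h) := by
  have : (counit (R := k) (A := A)) ∘ₗ LinearMap.mulLeft k (sourceMap k A g * h) =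
      counit ∘ₗ LinearMap.mulLeft k (g * h) := LinearMap.ext fun x => by
    simp only [LinearMap.comp_apply, LinearMap.mulLeft_apply, mul_assoc, counit_sourceMap_mul]
  simp only [sourceMap_eq_slice (k := k) (_ * h), this]

theorem mul_S_comul (h : A) :
    LinearMap.mul' k A ((S k A).lTensor A (comul h)) = targetMap k A h :=
  WeakHopfAlgebra.mul_antipode_right h

theorem S_mul_comul (h : A) :
    LinearMap.mul' k A ((S k A).rTensor A (comul h)) = sourceMap k A h :=
  WeakHopfAlgebra.mul_antipode_left h

theorem targetMap_target_mul {b : A} (hb : b ∈ targetBase k A) (h : A) :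
    targetMap k A (b * h) = b * targetMap k A h := by
  rw [← mul_S_comul, ← mul_S_comul, comul_target_mul h hb]
  generalize comul (R := k) h = t
  induction t using TensorProduct.induction_on with
  | zero => simp
  | tmul a b => simp [mul_assoc]
  | add x y hx hy => simp only [map_add, mul_add, hx, hy]

end Basic

theorem conv_ext {k A : Type*} [Field k] [Ring A] [Algebra k A]
    {f g : WithConv (A ⊗[k] A →ₗ[k] A)} (h : ∀ x y, f (x ⊗ₜ[k] y) = g (x ⊗ₜ[k] y)) : f = g :=
  WithConv.ofConv_injective (TensorProduct.ext' h)

/-! ### Convolution on A ⊗ A and antimultiplicativity of the antipode. -/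

section Antipode

variable {k : Type*} {A : Type*} [Field k] [Ring A] [Algebra k A] [WeakHopfAlgebra k A]

/-- The map `x ⊗ y ↦ ε(y) f(x)` on `A ⊗ A`. -/
def onLeft (f : WithConv (A →ₗ[k] A)) : WithConv (A ⊗[k] A →ₗ[k] A) :=
  .toConv ((TensorProduct.rid k A).toLinearMap ∘ₗ TensorProduct.map f.ofConv counit)

/-- The map `x ⊗ y ↦ ε(x) f(y)` on `A ⊗ A`. -/
def onRight (f : WithConv (A →ₗ[k] A)) : WithConv (A ⊗[k] A →ₗ[k] A) :=
  .toConv ((TensorProduct.lid k A).toLinearMap ∘ₗ TensorProduct.map counit f.ofConv)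

theorem comul_tmul_repr (x y : A) : comul (R := k) (x ⊗ₜ[k] y) =
    ∑ i ∈ (ℛ k x).index, ∑ j ∈ (ℛ k y).index,
      ((ℛ k x).left i ⊗ₜ[k] (ℛ k y).left j) ⊗ₜ[k] ((ℛ k x).right i ⊗ₜ[k] (ℛ k y).right j) := by
  rw [TensorProduct.comul_tmul, ← (ℛ k x).eq, ← (ℛ k y).eq]
  simp only [TensorProduct.sum_tmul, TensorProduct.tmul_sum, map_sum,
    TensorProduct.AlgebraTensorModule.tensorTensorTensorComm_tmul]
  exact Finset.sum_comm

theorem onLeft_mul_apply (f : WithConv (A →ₗ[k] A)) (F : WithConv (A ⊗[k] A →ₗ[k] A)) (x y : A) :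
    (onLeft f * F) (x ⊗ₜ[k] y) =
      ∑ i ∈ (ℛ k x).index, f ((ℛ k x).left i) * F ((ℛ k x).right i ⊗ₜ[k] y) := by
  rw [LinearMap.convMul_apply, comul_tmul_repr]
  simp only [map_sum, TensorProduct.map_tmul, LinearMap.mul'_apply]
  refine Finset.sum_congr rfl fun i _ => ?_
  conv_rhs => rw [← Coalgebra.sum_counit_smul (ℛ k y)]
  simp [onLeft, TensorProduct.tmul_sum, Finset.mul_sum]

theorem onRight_mul_apply (f : WithConv (A →ₗ[k] A)) (F : WithConv (A ⊗[k] A →ₗ[k] A)) (x y : A) :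
    (onRight f * F) (x ⊗ₜ[k] y) =
      ∑ i ∈ (ℛ k y).index, f ((ℛ k y).left i) * F (x ⊗ₜ[k] (ℛ k y).right i) := by
  rw [LinearMap.convMul_apply, comul_tmul_repr, Finset.sum_comm]
  simp only [map_sum, TensorProduct.map_tmul, LinearMap.mul'_apply]
  refine Finset.sum_congr rfl fun i _ => ?_
  conv_rhs => rw [← Coalgebra.sum_counit_smul (ℛ k x)]
  simp [onRight, TensorProduct.sum_tmul, Finset.mul_sum, TensorProduct.smul_tmul]

theorem sum_counit_smul_left (x : A) :
    ∑ i ∈ (ℛ k x).index, counit (R := k) ((ℛ k x).right i) • (ℛ k x).left i = x := by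
  have := congrArg (TensorProduct.rid k A) (Coalgebra.sum_tmul_counit_eq (ℛ k x))
  simpa only [map_sum, TensorProduct.rid_tmul, one_smul] using this

theorem onLeft_mul_onRight_apply (f g : WithConv (A →ₗ[k] A)) (x y : A) :
    (onLeft f * onRight g) (x ⊗ₜ[k] y) = f x * g y := by
  rw [onLeft_mul_apply]
  conv_rhs => rw [← sum_counit_smul_left (k := k) x]
  simp [onRight, Finset.sum_mul]

theorem onRight_mul_onLeft_apply (f g : WithConv (A →ₗ[k] A)) (x y : A) :
    (onRight g * onLeft f) (x ⊗ₜ[k] y) = g y * f x := by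
  rw [onRight_mul_apply]
  conv_rhs => rw [← sum_counit_smul_left (k := k) y]
  simp [onLeft, Finset.sum_mul]

theorem onLeft_mul_onLeft (f g : WithConv (A →ₗ[k] A)) :
    onLeft f * onLeft g = onLeft (f * g) := by
  refine conv_ext fun x y => ?_
  have := (ℛ k x).convMul_apply f g
  rw [onLeft_mul_apply]
  refine Eq.trans ?_ (congrArg (counit (R := k) y • ·) this.symm)
  simp [onLeft, Finset.smul_sum]

theorem onRight_mul_onRight (f g : WithConv (A →ₗ[k] A)) :
    onRight f * onRight g = onRight (f * g) := by
  refine conv_ext fun x y => ?_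
  have := (ℛ k y).convMul_apply f g
  rw [onRight_mul_apply]
  refine Eq.trans ?_ (congrArg (counit (R := k) x • ·) this.symm)
  simp [onRight, Finset.smul_sum]

/-- Because Δ is multiplicative, pulling back along the product of A respects convolution. -/
theorem comp_mul'_mul (f g : WithConv (A →ₗ[k] A)) :
    WithConv.toConv (f.ofConv ∘ₗ LinearMap.mul' k A) * .toConv (g.ofConv ∘ₗ LinearMap.mul' k A) =
      .toConv ((f * g).ofConv ∘ₗ LinearMap.mul' k A) := by
  refine conv_ext fun x y => ?_
  have h : (f * g) (x * y) =
      LinearMap.mul' k A (TensorProduct.map f.ofConv g.ofConv (comul x * comul y)) := by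
    rw [LinearMap.convMul_apply, WeakHopfAlgebra.comul_mul]
  rw [LinearMap.convMul_apply, comul_tmul_repr]
  refine Eq.trans ?_ h.symm
  rw [← (ℛ k x).eq, ← (ℛ k y).eq]
  simp [Finset.sum_mul_sum]

theorem onLeft_mul_onRight_comm {f g : WithConv (A →ₗ[k] A)}
    (h : ∀ x y, f x * g y = g y * f x) : onLeft f * onRight g = onRight g * onLeft f :=
  conv_ext fun x y => by rw [onLeft_mul_onRight_apply, onRight_mul_onLeft_apply, h]

theorem onLeft_mul_onRight_id :
    onLeft (k := k) (A := A) (.toConv .id) * onRight (.toConv .id) =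
      .toConv (LinearMap.mul' k A) :=
  conv_ext fun x y => by rw [onLeft_mul_onRight_apply]; simp

theorem id_mul_S : WithConv.toConv (LinearMap.id (R := k) (M := A)) * .toConv (S k A) =
    .toConv (targetMap k A) :=
  WithConv.ofConv_injective (LinearMap.ext fun x => mul_S_comul x)

theorem S_mul_id : WithConv.toConv (S k A) * .toConv (LinearMap.id (R := k) (M := A)) =
    .toConv (sourceMap k A) :=
  WithConv.ofConv_injective (LinearMap.ext fun x => S_mul_comul x)

theorem S_mul_id_mul_S : WithConv.toConv (S k A) * (.toConv (LinearMap.id (R := k) (M := A)) *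
    .toConv (S k A)) = .toConv (S k A) := by
  rw [← mul_assoc]
  refine WithConv.ofConv_injective (LinearMap.ext fun x => ?_)
  refine Eq.trans ?_ (WeakHopfAlgebra.antipode_eq x).symm
  change LinearMap.mul' k A (TensorProduct.map (LinearMap.mul' k A ∘ₗ
    TensorProduct.map (S k A) LinearMap.id ∘ₗ comul) (S k A) (comul x)) = _
  rw [← LinearMap.comp_assoc, ← LinearMap.map_comp_rTensor]
  rfl

/-- The left side is x₁ε_t(y)S(x₂). Since Δ(xb) = Δ(x)(b ⊗ 1) for b in A_t, this is ε_t(xε_t(y)). -/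
theorem onLeft_targetMap_onRight (x y : A) :
    (onLeft (k := k) (.toConv .id) * (onRight (.toConv (targetMap k A)) * onLeft (.toConv (S k A))) :
      WithConv (A ⊗[k] A →ₗ[k] A)) (x ⊗ₜ[k] y) = targetMap k A (x * y) := by
  rw [onLeft_mul_apply, ← targetMap_mul_targetMap, ← mul_S_comul,
    comul_mul_target _ (targetMap_mem y), ← (ℛ k x).eq]
  simp only [onRight_mul_onLeft_apply]
  simp [Finset.sum_mul, mul_assoc]

theorem onRight_sourceMap_onLeft (x y : A) :
    (onRight (k := k) (.toConv (S k A)) * (onLeft (.toConv (sourceMap k A)) * onRight (.toConv .id)) :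
      WithConv (A ⊗[k] A →ₗ[k] A)) (x ⊗ₜ[k] y) = sourceMap k A (x * y) := by
  rw [onRight_mul_apply, ← sourceMap_sourceMap_mul, ← S_mul_comul,
    comul_source_mul _ (sourceMap_mem x), ← (ℛ k y).eq]
  simp only [onLeft_mul_onRight_apply]
  simp [Finset.mul_sum]

/-- The antipode is antimultiplicative. -/
theorem S_mul (x y : A) : S k A (x * y) = S k A y * S k A x := by
  set ι : WithConv (A →ₗ[k] A) := .toConv .id with hι
  set σ : WithConv (A →ₗ[k] A) := .toConv (S k A) with hσ
  set et : WithConv (A →ₗ[k] A) := .toConv (targetMap k A) with het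
  set es : WithConv (A →ₗ[k] A) := .toConv (sourceMap k A) with hes
  set μ : WithConv (A ⊗[k] A →ₗ[k] A) := .toConv (LinearMap.mul' k A) with hμ
  set ν : WithConv (A ⊗[k] A →ₗ[k] A) := .toConv (S k A ∘ₗ LinearMap.mul' k A) with hν
  have hισ : ι * σ = et := id_mul_S
  have hσι : σ * ι = es := S_mul_id
  have hσσ : σ * (ι * σ) = σ := S_mul_id_mul_S
  have hμ' : μ = onLeft ι * onRight ι := onLeft_mul_onRight_id.symm
  have hcomm : onLeft es * onRight et = onRight et * onLeft es :=
    onLeft_mul_onRight_comm fun x y =>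
      commute_of_mem (k := k) (sourceMap_mem x) (targetMap_mem y)
  have h1 : μ * ν = .toConv (targetMap k A ∘ₗ LinearMap.mul' k A) := by
    have := comp_mul'_mul ι σ
    rwa [hισ] at this
  have h2 : ν * μ = .toConv (sourceMap k A ∘ₗ LinearMap.mul' k A) := by
    have := comp_mul'_mul σ ι
    rwa [hσι] at this
  have h3 : ν * (μ * ν) = ν := by
    have e := comp_mul'_mul ι σ
    have := comp_mul'_mul σ (ι * σ)
    rw [← e, hσσ] at this
    exact this
  -- Both ν = S(xy) and ρ = S(y)S(x) are generalised convolution inverses of the product μ, with μρ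
  -- = μν and ρμ = νμ. Therefore ν = νμν = ρμρ = ρ. Commutation of A_s with A_t is what gives ρμρ =
  -- ρ.
  set ρ := onRight σ * onLeft σ with hρ
  have h4 : μ * ρ = μ * ν := by
    rw [h1, hμ', hρ]
    calc onLeft ι * onRight ι * (onRight σ * onLeft σ)
        = onLeft ι * (onRight et * onLeft σ) := by
          rw [← hισ, ← onRight_mul_onRight]; simp only [mul_assoc]
      _ = _ := conv_ext fun x y => onLeft_targetMap_onRight x y
  have h5 : ρ * μ = ν * μ := by
    rw [h2, hμ', hρ]
    calc onRight σ * onLeft σ * (onLeft ι * onRight ι)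
        = onRight σ * (onLeft es * onRight ι) := by
          rw [← hσι, ← onLeft_mul_onLeft]; simp only [mul_assoc]
      _ = _ := conv_ext fun x y => onRight_sourceMap_onLeft x y
  have h6 : ρ * μ * ρ = ρ := by
    calc ρ * μ * ρ = onRight σ * (onLeft (σ * ι) * onRight (ι * σ)) * onLeft σ := by
          rw [hμ', hρ, ← onLeft_mul_onLeft, ← onRight_mul_onRight]; simp only [mul_assoc]
      _ = onRight (σ * (ι * σ)) * onLeft (σ * ι * σ) := by
          rw [hσι, hισ, hcomm, ← onRight_mul_onRight, ← onLeft_mul_onLeft]; simp only [mul_assoc]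
      _ = ρ := by rw [mul_assoc σ ι σ, hσσ]
  have h7 : ν = ρ := by rw [← h3, ← h4, ← mul_assoc, ← h5, h6]
  have := congrArg (fun f : WithConv (A ⊗[k] A →ₗ[k] A) => f (x ⊗ₜ[k] y)) h7
  simp only [hρ, onRight_mul_onLeft_apply] at this
  exact this

end Antipode

/-! ### The antipode on the two bases, and pivotal elements. -/

section Pivotal

variable {k : Type*} {A : Type*} [Field k] [Ring A] [Algebra k A] [WeakHopfAlgebra k A]

theorem S_S {G : Aˣ} (hG : IsPivotalElement k G) (x : A) : S k A (S k A x) = G * x * (G⁻¹ : Aˣ) :=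
  hG.2 x

theorem S_injective {G : Aˣ} (hG : IsPivotalElement k G) : Function.Injective (S k A) := by
  intro x y h
  have := congrArg (S k A) h
  rw [S_S hG, S_S hG] at this
  simpa using this

theorem S_surjective {G : Aˣ} (hG : IsPivotalElement k G) : Function.Surjective (S k A) :=
  fun x => ⟨S k A ((G⁻¹ : Aˣ) * x * G), by rw [S_S hG]; simp [mul_assoc]⟩

theorem S_one {G : Aˣ} (hG : IsPivotalElement k G) : S k A 1 = 1 := by
  obtain ⟨x, hx⟩ := S_surjective (k := k) hG 1
  have := S_mul (k := k) x 1
  rwa [mul_one, hx, mul_one, eq_comm] at this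

theorem targetMap_one : targetMap k A 1 = 1 := targetMap_of_mem (one_mem _)

theorem sourceMap_one : sourceMap k A 1 = 1 := sourceMap_of_mem (one_mem _)

/-- Since Δ(b) = Δ(1)(b ⊗ 1), antimultiplicativity pulls S(b) out of S(b₁)b₂ and leaves ε_s(1) = 1.
-/
theorem S_eq_sourceMap {b : A} (hb : b ∈ targetBase k A) : S k A b = sourceMap k A b := by
  rw [← S_mul_comul, mem_targetBase.1 hb]
  have : ∀ t : A ⊗[k] A, LinearMap.mul' k A ((S k A).rTensor A (t * (b ⊗ₜ[k] (1 : A)))) =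
      S k A b * LinearMap.mul' k A ((S k A).rTensor A t) := by
    intro t
    induction t using TensorProduct.induction_on with
    | zero => simp
    | tmul x y => simp [S_mul, mul_assoc]
    | add x y hx hy => simp only [map_add, mul_add, add_mul, hx, hy]
  rw [this, S_mul_comul, sourceMap_one, mul_one]

theorem S_eq_targetMap {a : A} (ha : a ∈ sourceBase k A) : S k A a = targetMap k A a := by
  rw [← mul_S_comul, mem_sourceBase.1 ha]
  have : ∀ t : A ⊗[k] A, LinearMap.mul' k A ((S k A).lTensor A (((1 : A) ⊗ₜ[k] a) * t)) =
      LinearMap.mul' k A ((S k A).lTensor A t) * S k A a := by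
    intro t
    induction t using TensorProduct.induction_on with
    | zero => simp
    | tmul x y => simp [S_mul, mul_assoc]
    | add x y hx hy => simp only [map_add, mul_add, add_mul, hx, hy]
  rw [this, mul_S_comul, targetMap_one, one_mul]

theorem S_mem_sourceBase {b : A} (hb : b ∈ targetBase k A) : S k A b ∈ sourceBase k A :=
  S_eq_sourceMap hb ▸ sourceMap_mem b

theorem S_mem_targetBase {a : A} (ha : a ∈ sourceBase k A) : S k A a ∈ targetBase k A :=
  S_eq_targetMap ha ▸ targetMap_mem a

theorem IsRegular.source (hreg : IsRegular k A) {a : A} (ha : a ∈ sourceBase k A) :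
    S k A (S k A a) = a := hreg a ((le_sup_left : sourceBase k A ≤ minimalSubalgebra k A) ha)

theorem IsRegular.target (hreg : IsRegular k A) {b : A} (hb : b ∈ targetBase k A) :
    S k A (S k A b) = b := hreg b ((le_sup_right : targetBase k A ≤ minimalSubalgebra k A) hb)

theorem pivotal_commute {G : Aˣ} (hG : IsPivotalElement k G) {x : A}
    (hx : S k A (S k A x) = x) : (G : A) * x = x * G := by
  rw [S_S hG, Units.mul_inv_eq_iff_eq_mul] at hx
  exact hx

/-- Applying ε to the left leg of Δ(G) = Δ(1)(G ⊗ G) gives G = ε_t(G)G, and G can be cancelled. -/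
theorem targetMap_groupLike {G : Aˣ} (hG : IsGroupLike k G) : targetMap k A (G : A) = 1 := by
  have h1 := congrArg (TensorProduct.lid k A) (Coalgebra.rTensor_counit_comul (R := k) (G : A))
  have h2 : ∀ t : A ⊗[k] A, TensorProduct.lid k A (counit.rTensor A (t * ((G : A) ⊗ₜ[k] (G : A)))) =
      TensorProduct.lid k A (counit.rTensor A (t * ((G : A) ⊗ₜ[k] (1 : A)))) * G := by
    intro t
    induction t using TensorProduct.induction_on with
    | zero => simp
    | tmul x y => simp
    | add x y hx hy => simp only [map_add, add_mul, hx, hy]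
  rw [hG.2, h2, TensorProduct.lid_tmul, one_smul, ← targetMap_apply] at h1
  exact G.isUnit.mul_right_cancel (h1.trans (one_mul _).symm)

theorem sum_mul_S {n : ℕ} {a b : Fin n → A} (hab : comul (R := k) (1 : A) = ∑ i, a i ⊗ₜ[k] b i) :
    ∑ i, a i * S k A (b i) = 1 := by
  have := mul_S_comul (k := k) (1 : A)
  rw [hab, targetMap_one] at this
  simpa using this

theorem sum_S_mul {n : ℕ} {a b : Fin n → A} (hab : comul (R := k) (1 : A) = ∑ i, a i ⊗ₜ[k] b i) :
    ∑ i, S k A (a i) * b i = 1 := by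
  have := S_mul_comul (k := k) (1 : A)
  rw [hab, sourceMap_one] at this
  simpa using this

/-- Regularity enters here: S carries 1₂S(1₁) to S²(1₁)S(1₂) = 1₁S(1₂) = 1, and S is injective. -/
theorem sum_mul_S' {G : Aˣ} (hG : IsPivotalElement k G) (hreg : IsRegular k A)
    {n : ℕ} {a b : Fin n → A} (hab : comul (R := k) (1 : A) = ∑ i, a i ⊗ₜ[k] b i)
    (ha : ∀ i, a i ∈ sourceBase k A) : ∑ i, b i * S k A (a i) = 1 := by
  apply S_injective (k := k) hG
  rw [S_one hG, map_sum, ← sum_mul_S hab]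
  simp [S_mul, hreg.source (ha _)]

theorem sum_S_mul' {G : Aˣ} (hG : IsPivotalElement k G) (hreg : IsRegular k A)
    {n : ℕ} {a b : Fin n → A} (hab : comul (R := k) (1 : A) = ∑ i, a i ⊗ₜ[k] b i)
    (hb : ∀ i, b i ∈ targetBase k A) : ∑ i, S k A (b i) * a i = 1 := by
  apply S_injective (k := k) hG
  rw [S_one hG, map_sum, ← sum_S_mul hab]
  simp [S_mul, hreg.target (hb _)]

/-- The separability property of the idempotent `S(1₂) ⊗ 1₁` of `A_s`. -/
theorem sum_S_tmul_mul (hreg : IsRegular k A)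
    {n : ℕ} {a b : Fin n → A} (hab : comul (R := k) (1 : A) = ∑ i, a i ⊗ₜ[k] b i)
    (hb : ∀ i, b i ∈ targetBase k A) {x : A} (hx : x ∈ sourceBase k A) :
    ∑ i, S k A (b i) ⊗ₜ[k] (a i * x) = ∑ i, (x * S k A (b i)) ⊗ₜ[k] a i := by
  -- For x in A_s this reads 1₁ ⊗ 1₂S(x) = 1₁x ⊗ 1₂. Applying S to the right leg turns 1₂S(x) into
  -- xS(1₂).
  have h := lTensor_targetMap_comul (k := k) x
  rw [comul_source' hx, hab] at h
  simp only [Finset.sum_mul, Algebra.TensorProduct.tmul_mul_tmul, mul_one, map_sum,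
    LinearMap.lTensor_tmul, targetMap_target_mul (hb _), ← S_eq_targetMap hx] at h
  have h' := congrArg (fun t => TensorProduct.comm k A A ((S k A).lTensor A t)) h
  simpa [S_mul, hreg.source hx] using h'.symm

/-- The inverse `x ↦ G⁻¹ S(x) G` of the antipode. -/
def antipodeInv (G : Aˣ) : A →ₗ[k] A :=
  LinearMap.mulLeft k ((G⁻¹ : Aˣ) : A) ∘ₗ LinearMap.mulRight k (G : A) ∘ₗ S k A

theorem antipodeInv_apply (G : Aˣ) (x : A) :
    antipodeInv (k := k) G x = (G⁻¹ : Aˣ) * (S k A x * G) := rfl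

theorem antipodeInv_mul (G : Aˣ) (x y : A) :
    antipodeInv (k := k) G (x * y) = antipodeInv (k := k) G y * antipodeInv (k := k) G x := by
  simp [antipodeInv_apply, S_mul, mul_assoc]

theorem antipodeInv_S {G : Aˣ} (hG : IsPivotalElement k G) (x : A) :
    antipodeInv (k := k) G (S k A x) = x := by
  simp [antipodeInv_apply, S_S hG, mul_assoc]

theorem pivotal_mul_antipodeInv (G : Aˣ) (x : A) :
    (G : A) * antipodeInv (k := k) G x = S k A x * G := by
  simp [antipodeInv_apply]

theorem antipodeInv_of_mem {G : Aˣ} (hG : IsPivotalElement k G) (hreg : IsRegular k A) {b : A}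
    (hb : b ∈ targetBase k A) : antipodeInv (k := k) G b = S k A b := by
  rw [antipodeInv_apply, ← pivotal_commute hG (hreg.source (S_mem_sourceBase hb))]
  simp

end Pivotal
-- Partial traces and the functional θ.
/-- Partial traces of equal maps `A → A ⊗ A` agree. -/
theorem sum_trace_smul_eq {k A : Type*} [Field k] [Ring A] [Algebra k A]
    {ι κ : Type*} {s : Finset ι} {t : Finset κ} {f : ι → Module.End k A}
    {c : ι → A} {g : κ → Module.End k A} {d : κ → A}
    (h : ∀ x, ∑ i ∈ s, f i x ⊗ₜ[k] c i = ∑ j ∈ t, g j x ⊗ₜ[k] d j) :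
    ∑ i ∈ s, LinearMap.trace k A (f i) • c i = ∑ j ∈ t, LinearMap.trace k A (g j) • d j := by
  rw [← sub_eq_zero, ← Module.forall_dual_apply_eq_zero_iff k]
  intro ψ
  have h1 : ∑ i ∈ s, ψ (c i) • f i = ∑ j ∈ t, ψ (d j) • g j := LinearMap.ext fun x => by
    simpa [sliceRight] using congrArg (sliceRight ψ) (h x)
  have := congrArg (LinearMap.trace k A) h1
  simp only [map_sum, map_smul, smul_eq_mul] at this
  simp only [map_sub, map_sum, map_smul, smul_eq_mul, mul_comm (LinearMap.trace k A _), this,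
    sub_self]

/-- The functional `x ↦ Tr_A(y ↦ x y G)`. -/
noncomputable def pivotalFunctional (k : Type*) {A : Type*} [Field k] [Ring A] [Algebra k A]
    (G : Aˣ) : A →ₗ[k] k :=
  LinearMap.trace k A ∘ₗ LinearMap.mulRight k (LinearMap.mulRight k (G : A)) ∘ₗ LinearMap.mul k A

theorem pivotalFunctional_apply {k A : Type*} [Field k] [Ring A] [Algebra k A]
    (G : Aˣ) (x : A) : pivotalFunctional k G x =
    LinearMap.trace k A (LinearMap.mulLeft k x ∘ₗ LinearMap.mulRight k (G : A)) := rfl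

theorem sum_sliceRight_coord {k A : Type*} [Field k] [Ring A] [Algebra k A]
    {ι : Type*} [Fintype ι] (e : Module.Basis ι k A) (t : A ⊗[k] A) :
    ∑ j, sliceRight (e.coord j) t ⊗ₜ[k] e j = t := by
  induction t using TensorProduct.induction_on with
  | zero => simp
  | tmul a b =>
    conv_rhs => rw [← e.sum_repr b, TensorProduct.tmul_sum]
    simp [sliceRight, TensorProduct.smul_tmul']
  | add s t hs ht =>
    conv_rhs => rw [← hs, ← ht]
    simp [TensorProduct.add_tmul, Finset.sum_add_distrib]

/-! ### The identity zG = S(z). -/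

section Integral

variable {k : Type*} {A : Type*} [Field k] [Ring A] [Algebra k A] [WeakHopfAlgebra k A]

/-- `x₁ ⊗ x₂S(x₃) = Δ(1)(x ⊗ 1)`. -/
theorem sum_comul_mul_S (x : A) :
    ∑ i ∈ (ℛ k x).index, comul (R := k) ((ℛ k x).left i) * ((1 : A) ⊗ₜ[k] S k A ((ℛ k x).right i)) =
      comul (R := k) (1 : A) * (x ⊗ₜ[k] (1 : A)) := by
  have h1 : ∀ (t : A ⊗[k] A) (y : A), (LinearMap.mul' k A ∘ₗ (S k A).lTensor A).lTensor A
      (TensorProduct.assoc k A A A (t ⊗ₜ[k] y)) = t * ((1 : A) ⊗ₜ[k] S k A y) := by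
    intro t y
    induction t using TensorProduct.induction_on with
    | zero => simp
    | tmul a b => simp
    | add s t hs ht => simp only [TensorProduct.add_tmul, map_add, add_mul, hs, ht]
  simp only [← h1]
  rw [← map_sum, ← map_sum, ← lTensor_targetMap_comul]
  have h2 : ∑ i ∈ (ℛ k x).index, comul (R := k) ((ℛ k x).left i) ⊗ₜ[k] (ℛ k x).right i =
      comul.rTensor A (comul x) := by
    conv_rhs => rw [← (ℛ k x).eq]
    simp
  rw [h2, Coalgebra.coassoc_apply, ← LinearMap.comp_apply, ← LinearMap.lTensor_comp]
  congr 2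
  exact LinearMap.ext fun y => mul_S_comul y

/-- `x₁ ⊗ x₃S⁻¹(x₂) = (id ⊗ S⁻¹)(Δ(1)(x ⊗ 1))`. -/
theorem sum_comul_antipodeInv {G : Aˣ} (hG : IsPivotalElement k G) (x : A) :
    ∑ i ∈ (ℛ k x).index, ((1 : A) ⊗ₜ[k] (ℛ k x).right i) *
        (antipodeInv G).lTensor A (comul (R := k) ((ℛ k x).left i)) =
      (antipodeInv G).lTensor A (comul (R := k) (1 : A) * (x ⊗ₜ[k] (1 : A))) := by
  -- The point is x₃S⁻¹(x₂) = S⁻¹(x₂S(x₃)), which reduces to S⁻¹ of the target counital map.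
  have h1 : ∀ (t : A ⊗[k] A) (y : A), (antipodeInv G ∘ₗ LinearMap.mul' k A ∘ₗ
      (S k A).lTensor A).lTensor A (TensorProduct.assoc k A A A (t ⊗ₜ[k] y)) =
      ((1 : A) ⊗ₜ[k] y) * (antipodeInv G).lTensor A t := by
    intro t y
    induction t using TensorProduct.induction_on with
    | zero => simp
    | tmul a b => simp [antipodeInv_mul, antipodeInv_S hG]
    | add s t hs ht => simp only [TensorProduct.add_tmul, map_add, mul_add, hs, ht]
  simp only [← h1]
  rw [← map_sum, ← map_sum, ← lTensor_targetMap_comul]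
  have h2 : ∑ i ∈ (ℛ k x).index, comul (R := k) ((ℛ k x).left i) ⊗ₜ[k] (ℛ k x).right i =
      comul.rTensor A (comul x) := by
    conv_rhs => rw [← (ℛ k x).eq]
    simp
  rw [h2, Coalgebra.coassoc_apply, ← LinearMap.comp_apply, ← LinearMap.lTensor_comp,
    ← LinearMap.comp_apply ((antipodeInv G).lTensor A), ← LinearMap.lTensor_comp]
  congr 2
  refine LinearMap.ext fun y => ?_
  simp only [LinearMap.comp_apply, mul_S_comul]

variable [FiniteDimensional k A]

/-- View x ↦ Δ(xG) and x ↦ x₁ ⊗ S⁻¹(x₂) as elements of End(A) ⊗ A. Multiplying their A-legs in a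
fixed order and composing their End(A)-legs in either order gives 1₁xG ⊗ 1₂G and 1₁xG ⊗ S⁻¹(1₂).
Cyclicity of the trace on End(A) equates θ(1₁)1₂G with θ(1₁)S⁻¹(1₂), and S⁻¹ = S on A_t by
regularity. -/
theorem sliceLeft_pivotalFunctional_mul {G : Aˣ} (hG : IsPivotalElement k G)
    (hreg : IsRegular k A) :
    sliceLeft (pivotalFunctional k G) (comul (R := k) (1 : A)) * G =
      S k A (sliceLeft (pivotalFunctional k G) (comul (R := k) (1 : A))) := by
  obtain ⟨n, a, b, ha, hb, hab⟩ := exists_comul_one k A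
  let e := Module.finBasis k A
  -- `f j` and `g j` are the End(A)-coefficients of the two operators along a basis of the second
  -- leg.
  let f (j) : Module.End k A := sliceRight (e.coord j) ∘ₗ comul ∘ₗ LinearMap.mulRight k (G : A)
  let g (j) : Module.End k A := sliceRight (e.coord j) ∘ₗ (antipodeInv G).lTensor A ∘ₗ comul
  have hf : ∀ x, ∑ j, f j x ⊗ₜ[k] e j = comul (R := k) (x * (G : A)) :=
    fun x => sum_sliceRight_coord e _
  have hg : ∀ x, ∑ j, g j x ⊗ₜ[k] e j = (antipodeInv G).lTensor A (comul (R := k) x) :=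
    fun x => sum_sliceRight_coord e _
  have h1 : ∀ x, ∑ p : Fin _ × Fin _, (f p.1 * g p.2) x ⊗ₜ[k] (e p.1 * e p.2) =
      ∑ i, (LinearMap.mulLeft k (a i) ∘ₗ LinearMap.mulRight k (G : A)) x ⊗ₜ[k] (b i * G) := by
    intro x
    have e1 : ∀ (u c : A), ∑ j, f j u ⊗ₜ[k] (e j * c) = comul (R := k) (u * G) * ((1 : A) ⊗ₜ[k] c) := by
      intro u c
      rw [← hf, Finset.sum_mul]
      simp
    let Ψ : A ⊗[k] A →ₗ[k] A ⊗[k] A := TensorProduct.lift (LinearMap.mk₂ k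
      (fun u c => ∑ j, f j u ⊗ₜ[k] (e j * c))
      (by intros; simp [TensorProduct.add_tmul, Finset.sum_add_distrib])
      (by intros; simp [TensorProduct.smul_tmul', Finset.smul_sum])
      (by intros; simp [TensorProduct.tmul_add, mul_add, Finset.sum_add_distrib])
      (by intros; simp [Finset.smul_sum]))
    have e2 := congrArg Ψ (hg x)
    rw [map_sum, ← (ℛ k x).eq] at e2
    simp only [map_sum, LinearMap.lTensor_tmul] at e2
    simp only [Ψ, TensorProduct.lift.tmul, LinearMap.mk₂_apply] at e2
    rw [Fintype.sum_prod_type_right]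
    refine e2.trans ?_
    -- Group-likeness and GS⁻¹(y) = S(y)G turn x₁G ⊗ x₂GS⁻¹(x₃) into (x₁ ⊗ x₂S(x₃))(G ⊗ G).
    have e3 := congrArg (· * ((G : A) ⊗ₜ[k] (G : A))) (sum_comul_mul_S (k := k) x)
    simp only [Finset.sum_mul, hab, mul_assoc, Algebra.TensorProduct.tmul_mul_tmul, one_mul] at e3
    simp only [e1]
    refine Eq.trans (Finset.sum_congr rfl fun i _ => ?_) (e3.trans (by simp))
    rw [WeakHopfAlgebra.comul_mul, hG.1.2, ← mul_assoc, comul_mul_one, mul_assoc,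
      Algebra.TensorProduct.tmul_mul_tmul, pivotal_mul_antipodeInv, mul_one]
  have h2 : ∀ x, ∑ p : Fin _ × Fin _, (g p.2 * f p.1) x ⊗ₜ[k] (e p.1 * e p.2) =
      ∑ i, (LinearMap.mulLeft k (a i) ∘ₗ LinearMap.mulRight k (G : A)) x ⊗ₜ[k] S k A (b i) := by
    intro x
    have e1 : ∀ (u c : A), ∑ j, g j u ⊗ₜ[k] (c * e j) =
        ((1 : A) ⊗ₜ[k] c) * (antipodeInv G).lTensor A (comul (R := k) u) := by
      intro u c
      rw [← hg, Finset.mul_sum]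
      simp
    let Ψ : A ⊗[k] A →ₗ[k] A ⊗[k] A := TensorProduct.lift (LinearMap.mk₂ k
      (fun u c => ∑ j, g j u ⊗ₜ[k] (c * e j))
      (by intros; simp [TensorProduct.add_tmul, Finset.sum_add_distrib])
      (by intros; simp [TensorProduct.smul_tmul', Finset.smul_sum])
      (by intros; simp [TensorProduct.tmul_add, add_mul, Finset.sum_add_distrib])
      (by intros; simp [Finset.smul_sum]))
    have e2 := congrArg Ψ (hf x)
    rw [map_sum, ← (ℛ k (x * (G : A))).eq] at e2
    simp only [map_sum] at e2
    simp only [Ψ, TensorProduct.lift.tmul, LinearMap.mk₂_apply] at e2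
    rw [Fintype.sum_prod_type]
    refine e2.trans ?_
    simp only [e1]
    rw [sum_comul_antipodeInv hG, hab]
    simp [Finset.sum_mul, antipodeInv_of_mem hG hreg (hb _)]
  have t1 := sum_trace_smul_eq h1
  have t2 := sum_trace_smul_eq h2
  simp only [LinearMap.trace_mul_comm k (f _)] at t1
  have t3 := t1.symm.trans t2
  simp only [← pivotalFunctional_apply] at t3
  rw [hab]
  simpa [sliceLeft, Finset.sum_mul] using t3

end Integral

/-! ### From zG = S(z) with z ≠ 0 to triviality of G. -/

section Trivial

variable {k : Type*} {A : Type*} [Field k] [Ring A] [Algebra k A] [WeakHopfAlgebra k A]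

theorem counit_mul_eq_dualTargetMap (a : A) :
    (counit (R := k) (A := A)) ∘ₗ LinearMap.mulLeft k a =
      dualTargetMap k A (counit ∘ₗ LinearMap.mulLeft k a) := by
  refine LinearMap.ext fun h => ?_
  have := WeakHopfAlgebra.counit_mul_right (k := k) a 1 h
  rw [mul_one] at this
  rw [LinearMap.comp_apply, LinearMap.mulLeft_apply, this]
  change _ = LinearMap.mul' k k (TensorProduct.map counit (counit ∘ₗ LinearMap.mulLeft k a)
    (comul (R := k) (1 : A) * (h ⊗ₜ[k] (1 : A))))
  generalize comul (R := k) (1 : A) = t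
  induction t using TensorProduct.induction_on with
  | zero => simp
  | tmul a b => simp
  | add x y hx hy => simp only [map_add, add_mul, hx, hy]

/-- The functional ε(a·) lies in the target base of A*. Multiplying by it from the left (using a ∈
A_t) or from the right (using a ∈ A_s) is precomposition with h ↦ ah, so it is central. Hence ε(a·)
= cε, and counitality recovers a = c1. -/
theorem IsCoconnected.exists_smul_one (hco : IsCoconnected k A) {a : A}
    (hs : a ∈ sourceBase k A) (ht : a ∈ targetBase k A) : ∃ c : k, a = c • (1 : A) := by
  have h1 : ∀ ψ : A →ₗ[k] k,
      dualMul k A (counit ∘ₗ LinearMap.mulLeft k a) ψ = ψ ∘ₗ LinearMap.mulLeft k a := by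
    intro ψ
    refine LinearMap.ext fun h => ?_
    have e := congrArg (TensorProduct.lid k A) (Coalgebra.rTensor_counit_comul (R := k) (a * h))
    rw [comul_target_mul h ht, TensorProduct.lid_tmul, one_smul] at e
    simp only [LinearMap.comp_apply, dualMul, LinearMap.mulLeft_apply]
    rw [← e]
    generalize comul (R := k) h = t
    induction t using TensorProduct.induction_on with
    | zero => simp
    | tmul a b => simp
    | add x y hx hy => simp only [map_add, mul_add, hx, hy]
  have h2 : ∀ ψ : A →ₗ[k] k,
      dualMul k A ψ (counit ∘ₗ LinearMap.mulLeft k a) = ψ ∘ₗ LinearMap.mulLeft k a := by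
    intro ψ
    refine LinearMap.ext fun h => ?_
    have e := congrArg (TensorProduct.rid k A) (Coalgebra.lTensor_counit_comul (R := k) (a * h))
    rw [comul_source_mul h hs, TensorProduct.rid_tmul, one_smul] at e
    simp only [LinearMap.comp_apply, dualMul, LinearMap.mulLeft_apply]
    rw [← e]
    generalize comul (R := k) h = t
    induction t using TensorProduct.induction_on with
    | zero => simp
    | tmul a b => simp [mul_comm]
    | add x y hx hy => simp only [map_add, mul_add, hx, hy]
  obtain ⟨c, hc⟩ := hco _ ⟨_, counit_mul_eq_dualTargetMap a⟩ fun ψ => (h1 ψ).trans (h2 ψ).symm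
  refine ⟨c, ?_⟩
  have e := congrArg (TensorProduct.lid k A) (Coalgebra.rTensor_counit_comul (R := k) a)
  rw [comul_target' ht, TensorProduct.lid_tmul, one_smul] at e
  have e' := congrArg (TensorProduct.lid k A) (Coalgebra.rTensor_counit_comul (R := k) (1 : A))
  rw [TensorProduct.lid_tmul, one_smul] at e'
  have key : ∀ t : A ⊗[k] A, TensorProduct.lid k A (counit.rTensor A ((a ⊗ₜ[k] (1 : A)) * t)) =
      c • TensorProduct.lid k A (counit.rTensor A t) := by
    intro t
    induction t using TensorProduct.induction_on with
    | zero => simp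
    | tmul x y =>
      have := LinearMap.congr_fun hc x
      simp only [LinearMap.comp_apply, LinearMap.mulLeft_apply, LinearMap.smul_apply,
        smul_eq_mul] at this
      simp [this, mul_smul]
    | add x y hx hy => simp only [map_add, mul_add, smul_add, hx, hy]
  rw [← e, key, e']

/-- The source base of a regular weak Hopf algebra with a pivotal element is semisimple. -/
theorem isSemisimpleRing_sourceBase {G : Aˣ} (hG : IsPivotalElement k G) (hreg : IsRegular k A) :
    IsSemisimpleRing (sourceBase k A) := by
  obtain ⟨n, a, b, ha, hb, hab⟩ := exists_comul_one k A
  refine { exists_isCompl := fun N => ?_ }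
  let R := sourceBase k A
  obtain ⟨q, hq⟩ := LinearMap.exists_leftInverse_of_injective
    ((sourceBase k A).val.toLinearMap ∘ₗ (N.restrictScalars k).subtype)
    (LinearMap.ker_eq_bot.2 (Subtype.val_injective.comp Subtype.val_injective))
  have hq' : ∀ y : N, q (y : R) = y := fun y => LinearMap.congr_fun hq y
  -- Maschke-style averaging: the linear retraction q is made A_s-linear by the separability
  -- idempotent S(1₂) ⊗ 1₁.
  let p : R →ₗ[R] R :=
    { toFun := fun m => ∑ i, (⟨S k A (b i), S_mem_sourceBase (hb i)⟩ : R) * ((q (a i * m) : N) : R)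
      map_add' := fun x y => by simp [mul_add, Finset.sum_add_distrib]
      map_smul' := fun x m => by
        let Φ : A ⊗[k] A →ₗ[k] A := TensorProduct.lift (LinearMap.mk₂ k
          (fun u c => u * ((q (c * m) : N) : R))
          (by intros; simp [add_mul])
          (by intros; simp)
          (by intros; simp [add_mul, mul_add])
          (by intros; simp))
        have h := congrArg Φ (sum_S_tmul_mul hreg hab hb x.2)
        apply Subtype.ext
        simpa [Φ, mul_assoc, Finset.mul_sum] using h }
  have hp : ∀ m, p m ∈ N := fun m => N.sum_mem (t := Finset.univ)
    (f := fun i => (⟨S k A (b i), S_mem_sourceBase (hb i)⟩ : R) * ((q (a i * m) : N) : R))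
    fun i _ => N.smul_mem _ (q (a i * m)).2
  refine ⟨LinearMap.ker (p.codRestrict N hp),
    LinearMap.isCompl_of_proj (f := p.codRestrict N hp) fun y => ?_⟩
  apply Subtype.ext
  apply Subtype.ext
  have h1 : ∀ i, ((q (a i * ((y : R) : A)) : N) : R) = (⟨a i, ha i⟩ : R) * y :=
    fun i => congrArg Subtype.val (hq' ((⟨a i, ha i⟩ : R) • y))
  have h2 := congrArg (· * ((y : R) : A)) (sum_S_mul' hG hreg hab hb)
  simp only [Finset.sum_mul, one_mul, mul_assoc] at h2
  simpa [p, h1] using h2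

/-- A pivotal element `G` is trivial as soon as `z G = S(z)` for some nonzero `z ∈ A_t`. -/
theorem isTrivialGroupLike_of_mul_eq {G : Aˣ} (hG : IsPivotalElement k G) (hreg : IsRegular k A)
    (hco : IsCoconnected k A) {z : A} (hz : z ∈ targetBase k A) (hz0 : z ≠ 0)
    (h : z * G = S k A z) : IsTrivialGroupLike k G := by
  have := isSemisimpleRing_sourceBase hG hreg
  set w := S k A z with hw
  have hws : w ∈ sourceBase k A := S_mem_sourceBase hz
  have hSw : S k A w = z := hreg.target hz
  -- In w = zG both factors commute with A_s: z because it lies in A_t, G because S² is trivial on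
  -- A_s.
  have hcent : ∀ x ∈ sourceBase k A, x * w = w * x := fun x hx => by
    rw [← h, ← mul_assoc, commute_of_mem hx hz, mul_assoc, mul_assoc,
      pivotal_commute hG (hreg.source hx)]
  obtain ⟨e, he, hspan⟩ := IsSemisimpleRing.ideal_eq_span_idempotent
    (Ideal.span {(⟨w, hws⟩ : sourceBase k A)})
  have h1 : e ∈ Ideal.span {(⟨w, hws⟩ : sourceBase k A)} := hspan ▸ Ideal.mem_span_singleton_self e
  have h2 : (⟨w, hws⟩ : sourceBase k A) ∈ Ideal.span {e} :=
    hspan ▸ Ideal.mem_span_singleton_self _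
  obtain ⟨u, hu⟩ := Ideal.mem_span_singleton'.1 h1
  obtain ⟨v, hv⟩ := Ideal.mem_span_singleton'.1 h2
  obtain ⟨e, hes⟩ := e
  obtain ⟨u, hus⟩ := u
  obtain ⟨v, hvs⟩ := v
  simp only [IsIdempotentElem, MulMemClass.mk_mul_mk, Subtype.mk.injEq] at he hu hv
  have hwe : w * e = w := by rw [← hv, mul_assoc, he]
  have hew : e * w = w := (hcent e hes).trans hwe
  have hez : e * z = z := by
    have : z = w * (G⁻¹ : Aˣ) := by rw [← h]; simp
    rw [this, ← mul_assoc, hew]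
  have hSe : S k A e * z = z := by rw [← hSw, ← S_mul, hwe]
  have hSew : S k A e * w = w := by rw [← h, ← mul_assoc, hSe]
  have hSet : S k A e ∈ targetBase k A := S_mem_targetBase hes
  -- Left multiplication by e fixes z and by S(e) fixes w. With S(e) = zS(u) and e = uw this gives
  -- eS(e) = S(e) and S(e)e = e; as e and S(e) commute, they are equal.
  have e1 : e * S k A e = S k A e := by
    rw [← hu, S_mul, hSw, ← mul_assoc, hu, hez]
  have e2 : S k A e * e = e := by
    rw [show S k A e * e = S k A e * (u * w) by rw [hu], ← mul_assoc,
      ← commute_of_mem hus hSet, mul_assoc, hSew, hu]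
  have e3 : e = S k A e := by rw [← e1, commute_of_mem hes hSet, e2]
  obtain ⟨c, hc⟩ := hco.exists_smul_one hes (e3 ▸ hSet)
  have hw0 : w ≠ 0 := fun h0 => hz0 (by rw [← hSw, h0, map_zero])
  have hc1 : e = 1 := by
    have hc0 : c ≠ 0 := by
      rintro rfl
      rw [zero_smul] at hc
      exact hw0 (by rw [← hwe, hc, mul_zero])
    have : c • e = c • (1 : A) := by
      rw [← hc]
      conv_rhs => rw [← he]
      conv_rhs => rw [hc, smul_one_mul, ← hc]
    exact smul_right_injective A hc0 this
  rw [hc1] at hu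
  let y : Aˣ := ⟨w, u, by rw [← hcent u hus, hu], hu⟩
  refine ⟨y, y * G⁻¹, hws, ?_, ?_⟩
  · rw [Units.val_mul]
    change w * _ = S k A w
    rw [hSw, ← h]
    simp
  · have : G * y = y * G := Units.ext (pivotal_commute hG (hreg.source hws))
    rw [mul_inv_rev, inv_inv, ← mul_assoc, ← this, mul_assoc, mul_inv_cancel, mul_one]

/-- Writing s = 1₁ε(s1₂) gives θ(s) = ε(sz), so z cannot vanish. -/
theorem isTrivialGroupLike_of_pivotalFunctional [FiniteDimensional k A] {G : Aˣ}
    (hG : IsPivotalElement k G) (hreg : IsRegular k A) (hco : IsCoconnected k A) {s : A}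
    (hs : s ∈ sourceBase k A) (h : pivotalFunctional k G s ≠ 0) : IsTrivialGroupLike k G := by
  refine isTrivialGroupLike_of_mul_eq hG hreg hco (sliceLeft_mem (pivotalFunctional k G)) ?_
    (sliceLeft_pivotalFunctional_mul hG hreg)
  intro h0
  apply h
  rw [← sourceMap_of_mem hs, sourceMap_eq_slice]
  have key : ∀ (φ ψ : A →ₗ[k] k) (t : A ⊗[k] A), φ (sliceRight ψ t) = ψ (sliceLeft φ t) := by
    intro φ ψ t
    induction t using TensorProduct.induction_on with
    | zero => simp
    | tmul x y => simp [sliceLeft, sliceRight, mul_comm]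
    | add x y hx hy => simp only [map_add, hx, hy]
  rw [key, h0, map_zero]

end Trivial

/-! ### Quantum dimensions as character values. -/

section Dimension

variable {k : Type*} {A : Type*} [Field k] [Ring A] [Algebra k A]

theorem trace_eq_sum_coord {ι V : Type*} [Fintype ι] [AddCommGroup V] [Module k V]
    (e : Module.Basis ι k V) (f : Module.End k V) :
    LinearMap.trace k V f = ∑ i, e.coord i (f (e i)) := by
  classical
  rw [LinearMap.trace_eq_matrix_trace k e, Matrix.trace]
  simp [LinearMap.toMatrix_apply]

variable (k) in
/-- The character of a module. -/
noncomputable def character (V : Type*) [AddCommGroup V] [Module k V] [Module A V]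
    [IsScalarTower k A V] : A →ₗ[k] k :=
  LinearMap.trace k V ∘ₗ (Algebra.lsmul k k V).toLinearMap

theorem character_apply (V : Type*) [AddCommGroup V] [Module k V] [Module A V]
    [IsScalarTower k A V] (x : A) :
    character k V x = LinearMap.trace k V (Algebra.lsmul k k V x) := rfl

theorem character_mul_comm (V : Type*) [AddCommGroup V] [Module k V] [Module A V]
    [IsScalarTower k A V] (x y : A) : character k V (x * y) = character k V (y * x) := by
  rw [character_apply, character_apply, map_mul (Algebra.lsmul k k V),
    map_mul (Algebra.lsmul k k V), LinearMap.trace_mul_comm]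

variable [WeakHopfAlgebra k A]

theorem dualAction_apply {V : Type*} [AddCommGroup V] [Module k V] (ρ : A →ₗ[k] Module.End k V)
    (x : A) (ξ : Module.Dual k V) (v : V) : dualAction ρ x ξ v = ξ (ρ (S k A x) v) := rfl

theorem evalAux_dualAction_pivotalMap {V : Type*} [AddCommGroup V] [Module k V] [Module A V]
    [IsScalarTower k A V] {n : ℕ} {a b : Fin n → A}
    (hab : comul (R := k) (1 : A) = ∑ i, a i ⊗ₜ[k] b i) (G : Aˣ) (v : V) (ξ : Module.Dual k V) :
    evalAux (dualAction (Algebra.lsmul k k V).toLinearMap)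
      ((pivotalMap G (Algebra.lsmul k k V).toLinearMap).rTensor (Module.Dual k V) (v ⊗ₜ ξ)) =
      ∑ j, ξ ((S k A (a j) * G) • v) • b j := by
  simp [evalAux, sliceLeft, hab, pivotalMap, dualAction_apply, mul_smul]

theorem quantumTrace_apply {V : Type*} [AddCommGroup V] [Module k V] [Module A V]
    [IsScalarTower k A V] [FiniteDimensional k V] {n : ℕ} {a b : Fin n → A}
    (hab : comul (R := k) (1 : A) = ∑ i, a i ⊗ₜ[k] b i) (G : Aˣ) (z : targetBase k A) :
    (quantumTrace G (Algebra.lsmul k k V).toLinearMap z : A) =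
      ∑ j, character k V (z * (S k A (a j) * G)) • b j := by
  have h1 : (quantumTrace G (Algebra.lsmul k k V).toLinearMap z : A) =
      evalAux (dualAction (Algebra.lsmul k k V).toLinearMap)
      ((pivotalMap G (Algebra.lsmul k k V).toLinearMap).rTensor (Module.Dual k V)
        (tensorAction (Algebra.lsmul k k V).toLinearMap
          (dualAction (Algebra.lsmul k k V).toLinearMap) (z : A) (_root_.coevaluation k V 1))) := rfl
  have h2 : tensorAction (Algebra.lsmul k k V).toLinearMap
      (dualAction (Algebra.lsmul k k V).toLinearMap) (z : A) (_root_.coevaluation k V 1) =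
      ∑ i, ∑ m ∈ (ℛ k (z : A)).index,
        ((ℛ k (z : A)).left m • Module.Basis.ofVectorSpace k V i) ⊗ₜ[k]
          dualAction (Algebra.lsmul k k V).toLinearMap ((ℛ k (z : A)).right m)
            ((Module.Basis.ofVectorSpace k V).coord i) := by
    rw [coevaluation_apply_one, map_sum]
    refine Finset.sum_congr rfl fun i _ => ?_
    rw [tensorAction, LinearMap.comp_apply, LinearMap.comp_apply, ← (ℛ k (z : A)).eq]
    simp
  rw [h1, h2]
  simp only [map_sum, evalAux_dualAction_pivotalMap hab]
  -- Cyclicity of the character brings z₁ and S(z₂) together, and z₁S(z₂) = ε_t(z) = z on A_t.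
  have h3 : (z : A) = ∑ m ∈ (ℛ k (z : A)).index,
      (ℛ k (z : A)).left m * S k A ((ℛ k (z : A)).right m) := by
    conv_lhs => rw [← targetMap_of_mem z.2, ← mul_S_comul, ← (ℛ k (z : A)).eq]
    simp
  rw [Finset.sum_congr rfl fun i _ => Finset.sum_comm, Finset.sum_comm]
  refine Finset.sum_congr rfl fun j _ => ?_
  simp only [← Finset.sum_smul]
  congr 1
  conv_rhs => rw [h3]
  rw [Finset.sum_mul, map_sum, Finset.sum_comm]
  refine Finset.sum_congr rfl fun m _ => ?_
  rw [mul_assoc, character_mul_comm, character_apply,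
    trace_eq_sum_coord (Module.Basis.ofVectorSpace k V)]
  refine Finset.sum_congr rfl fun i _ => ?_
  simp [dualAction_apply, mul_smul]

/-- The quantum dimension is a multiple of the value of the character at the pivotal element. -/
theorem quantumDim_eq {V : Type*} [AddCommGroup V] [Module k V] [Module A V]
    [IsScalarTower k A V] [FiniteDimensional k V] [FiniteDimensional k A] {G : Aˣ}
    (hG : IsPivotalElement k G) (hreg : IsRegular k A) :
    quantumDim k V G = character k V (G : A) / (Module.finrank k (targetBase k A) : k) := by
  obtain ⟨n, a, b, ha, hb, hab⟩ := exists_comul_one k A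
  rw [quantumDim]
  congr 1
  have h : quantumTrace G (Algebra.lsmul k k V).toLinearMap =
      ∑ j, LinearMap.smulRight (character k V ∘ₗ LinearMap.mulRight k (S k A (a j) * G) ∘ₗ
        (targetBase k A).val.toLinearMap) (⟨b j, hb j⟩ : targetBase k A) := by
    refine LinearMap.ext fun z => Subtype.ext ?_
    rw [quantumTrace_apply hab, LinearMap.sum_apply, AddSubmonoidClass.coe_finsetSum]
    rfl
  -- The endomorphism of A_t is a sum of rank-one maps, with trace ∑ χ(1₂S(1₁)G) = χ(G).
  rw [h, map_sum]
  simp only [LinearMap.trace_smulRight]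
  have := congrArg (fun x => character k V (x * (G : A))) (sum_mul_S' hG hreg hab ha)
  simpa [Finset.sum_mul, mul_assoc] using this

end Dimension

/-! ### Block decomposition of a semisimple algebra. -/

section Semisimple

variable {k : Type*} {A : Type u} [Field k] [Ring A] [Algebra k A]
variable {ι : Type*} {V : ι → Type u} [∀ j, AddCommGroup (V j)] [∀ j, Module k (V j)]
  [∀ j, Module A (V j)] [∀ j, IsScalarTower k A (V j)]

theorem eq_zero_of_forall_smul_eq_zero [IsSemisimpleRing A] (hV : IsSimpleList A V) {a : A}
    (h : ∀ j (v : V j), a • v = 0) : a = 0 := by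
  have h1 : ∀ x : A, a * x = 0 := by
    intro x
    have hx : x ∈ sSup {m : Submodule A A | IsSimpleModule A m} := by
      rw [IsSemisimpleModule.sSup_simples_eq_top]; trivial
    rw [sSup_eq_iSup'] at hx
    induction hx using Submodule.iSup_induction' with
    | zero => simp
    | add x y _ _ hx hy => rw [mul_add, hx, hy, add_zero]
    | mem m x hx =>
      obtain ⟨m, hm⟩ := m
      have : IsSimpleModule A m := hm
      obtain ⟨j, ⟨e⟩⟩ := hV.complete m this
      have : a • (⟨x, hx⟩ : m) = 0 := e.injective (by rw [map_smul, h, map_zero])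
      exact congrArg Subtype.val this
  simpa using h1 1

/-- The action of `A` on all irreducible modules. -/
def totalAction (k : Type*) {A : Type u} [Field k] [Ring A] [Algebra k A] {ι : Type*}
    (V : ι → Type u) [∀ j, AddCommGroup (V j)] [∀ j, Module k (V j)]
    [∀ j, Module A (V j)] [∀ j, IsScalarTower k A (V j)] : A →ₗ[k] Π j, Module.End k (V j) :=
  LinearMap.pi fun j => (Algebra.lsmul k k (V j)).toLinearMap

theorem totalAction_injective [IsSemisimpleRing A] (hV : IsSimpleList A V) :
    Function.Injective (totalAction (A := A) k V) := by
  rw [injective_iff_map_eq_zero]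
  intro a ha
  exact eq_zero_of_forall_smul_eq_zero hV fun j v => LinearMap.congr_fun (congrFun ha j) v

theorem finiteDimensional_of_isSimpleList [IsSemisimpleRing A] [Finite ι]
    [∀ j, FiniteDimensional k (V j)] (hV : IsSimpleList A V) : FiniteDimensional k A := by
  have := Fintype.ofFinite ι
  exact FiniteDimensional.of_injective _ (totalAction_injective (k := k) hV)

/-- By Schur's lemma an A-endomorphism of ∏ Vⱼ is a scalar on each factor, so it commutes with every
blockwise operator. Jacobson density then realises such an operator by an element of A. -/
theorem totalAction_surjective [IsSemisimpleRing A] [Finite ι] [IsAlgClosed k]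
    [∀ j, FiniteDimensional k (V j)] (hV : IsSimpleList A V) :
    Function.Surjective (totalAction (A := A) k V) := by
  classical
  have := Fintype.ofFinite ι
  have hs := hV.simple
  intro X
  let f : Module.End (Module.End A (Π j, V j)) (Π j, V j) :=
    { toFun := fun v j => X j (v j)
      map_add' := fun v w => by ext j; simp
      map_smul' := fun φ v => by
        funext i
        have h1 : ∀ w : Π j, V j, (φ w) i = ∑ j, φ (Pi.single j (w j)) i := by
          intro w
          conv_lhs => rw [← Finset.univ_sum_single w, map_sum, Finset.sum_apply]
        change X i ((φ v) i) = (φ fun j => X j (v j)) i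
        rw [h1, h1, map_sum]
        refine Finset.sum_congr rfl fun j _ => ?_
        let ψ : V j →ₗ[A] V i := LinearMap.proj i ∘ₗ φ ∘ₗ LinearMap.single A V j
        change X i (ψ (v j)) = ψ (X j (v j))
        by_cases hij : j = i
        · subst hij
          obtain ⟨c, hc⟩ := (IsSimpleModule.algebraMap_end_bijective_of_isAlgClosed
            (A := A) (V := V j) k).2 ψ
          rw [← hc]
          simp
        · have : ψ = 0 := by
            by_contra h0
            exact hij (hV.irredundant j i
              ⟨LinearEquiv.ofBijective ψ (LinearMap.bijective_of_ne_zero h0)⟩)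
          rw [this]
          simp }
  -- Density gives agreement only on a finite set; basis vectors of every block determine the
  -- operator.
  let s : Finset (Π j, V j) := Finset.univ.biUnion fun j : ι =>
    Finset.univ.image fun m => Pi.single j (Module.finBasis k (V j) m)
  obtain ⟨r, hr⟩ := jacobson_density (R := A) f s
  refine ⟨r, funext fun j => (Module.finBasis k (V j)).ext fun m => ?_⟩
  have h := congrFun (hr (Pi.single j (Module.finBasis k (V j) m))
    (by simp [s]; exact ⟨j, m, rfl⟩)) j
  simpa [f, totalAction] using h.symm

/-- Under End V ≅ V* ⊗ V the map X ↦ aXb becomes bᵗ ⊗ a, whose trace is multiplicative. -/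
theorem trace_mulLeft_mulRight_end {k V : Type*} [Field k] [AddCommGroup V] [Module k V]
    [FiniteDimensional k V] (a b : Module.End k V) :
    LinearMap.trace k (Module.End k V) (LinearMap.mulLeft k a ∘ₗ LinearMap.mulRight k b) =
      LinearMap.trace k V a * LinearMap.trace k V b := by
  let e : Module.Dual k V ⊗[k] V ≃ₗ[k] Module.End k V := dualTensorHomEquiv k V V
  have h : LinearMap.mulLeft k a ∘ₗ LinearMap.mulRight k b =
      e.conj (TensorProduct.map (Module.Dual.transpose b) a) := by
    refine LinearMap.ext fun X => ?_
    obtain ⟨t, rfl⟩ := e.surjective X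
    rw [LinearEquiv.conj_apply_apply, LinearEquiv.symm_apply_apply]
    induction t using TensorProduct.induction_on with
    | zero => simp
    | add x y hx hy => simp only [map_add, hx, hy]
    | tmul φ v =>
      refine LinearMap.ext fun w => ?_
      change a (φ (b w) • v) = φ (b w) • a v
      rw [map_smul]
  have h' := LinearMap.trace_conj' (R := k) (M := Module.Dual k V ⊗[k] V) (N := Module.End k V)
    (TensorProduct.map (Module.Dual.transpose b) a) e
  refine (congrArg _ h).trans (h'.trans ?_)
  rw [LinearMap.trace_tensorProduct', LinearMap.trace_transpose', mul_comm]

/-- The trace of `x ↦ a x b` on a semisimple algebra. -/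
theorem trace_mulLeft_mulRight [IsSemisimpleRing A] [Fintype ι] [IsAlgClosed k]
    [∀ j, FiniteDimensional k (V j)] (hV : IsSimpleList A V) (a b : A) :
    LinearMap.trace k A (LinearMap.mulLeft k a ∘ₗ LinearMap.mulRight k b) =
      ∑ j, character k (V j) a * character k (V j) b := by
  classical
  have := finiteDimensional_of_isSimpleList (k := k) hV
  let e := LinearEquiv.ofBijective (totalAction (A := A) k V)
    ⟨totalAction_injective hV, totalAction_surjective hV⟩
  have he : ∀ x j, e x j = Algebra.lsmul k k (V j) x := fun _ _ => rfl
  let F := LinearMap.mulLeft k a ∘ₗ LinearMap.mulRight k b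
  let q (j) : A →ₗ[k] Module.End k (V j) := LinearMap.proj j ∘ₗ e.toLinearMap
  let s (j) : Module.End k (V j) →ₗ[k] A :=
    e.symm.toLinearMap ∘ₗ LinearMap.single k (fun j => Module.End k (V j)) j
  -- Splitting along block inclusions and projections lets the cyclic trace be computed on each
  -- End(Vⱼ).
  have hsum : F = ∑ j, (F ∘ₗ s j) ∘ₗ q j := LinearMap.ext fun x => by
    have : x = ∑ j, s j (q j x) := by
      apply e.injective
      simp only [map_sum, s, q, LinearMap.comp_apply, LinearEquiv.coe_coe,
        LinearEquiv.apply_symm_apply]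
      exact (Finset.univ_sum_single (e x)).symm
    conv_lhs => rw [this, map_sum]
    simp
  change LinearMap.trace k A F = _
  rw [hsum, map_sum]
  refine Finset.sum_congr rfl fun j _ => ?_
  rw [LinearMap.trace_comp_comm']
  rw [character_apply, character_apply, ← trace_mulLeft_mulRight_end]
  congr 1
  refine LinearMap.ext fun X => ?_
  change e (a * (e.symm (Pi.single j X) * b)) j = _
  rw [he, map_mul (Algebra.lsmul k k (V j)), map_mul (Algebra.lsmul k k (V j)), ← he (e.symm _)]
  simp

end Semisimple

/-! ### Restriction multiplicities and a summand of the unit object. -/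

section Multiplicity

variable {k : Type*} {A : Type u} [Field k] [Ring A] [Algebra k A]

/-- Multiplicities of a simple module over a semisimple subalgebra are the values of the characters
at an idempotent. -/
theorem exists_character_eq_finrank {R : Subalgebra k A} [IsSemisimpleRing R] (W : Type*)
    [AddCommGroup W] [Module R W] [IsSimpleModule R W] :
    ∃ p : R, ∀ (V : Type u) [AddCommGroup V] [Module k V] [Module A V] [IsScalarTower k A V]
      [FiniteDimensional k V], FiniteDimensional k (W →ₗ[R] V) ∧
        (Module.finrank k (W →ₗ[R] V) : k) = character k V (p : A) := by
  obtain ⟨I, ⟨e⟩⟩ := IsSemisimpleRing.exists_linearEquiv_ideal_of_isSimpleModule R W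
  obtain ⟨p, hp, rfl⟩ := IsSemisimpleRing.ideal_eq_span_idempotent I
  refine ⟨p, fun V _ _ _ _ _ => ?_⟩
  let w : W := e.symm ⟨p, Ideal.mem_span_singleton_self p⟩
  have hw : ∀ x : W, ∃ r : R, x = r • w := by
    intro x
    obtain ⟨r, hr⟩ := Ideal.mem_span_singleton'.1 (e x).2
    refine ⟨r, e.injective ?_⟩
    rw [map_smul, LinearEquiv.apply_symm_apply]
    exact Subtype.ext hr.symm
  have hpw : p • w = w := by
    apply e.injective
    rw [map_smul, LinearEquiv.apply_symm_apply]
    exact Subtype.ext hp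
  -- Evaluation at the generator w corresponding to p identifies Hom_R(Rp, V) with pV, and the rank
  -- of a projection is its trace.
  let Φ : (W →ₗ[R] V) →ₗ[k] V :=
    { toFun := fun f => f w
      map_add' := fun _ _ => rfl
      map_smul' := fun _ _ => rfl }
  have hinj : Function.Injective Φ := by
    intro f g hfg
    refine LinearMap.ext fun x => ?_
    obtain ⟨r, rfl⟩ := hw x
    rw [map_smul, map_smul]
    exact congrArg (r • ·) hfg
  have hrange : LinearMap.range Φ = LinearMap.range (Algebra.lsmul k k V (p : A)) := by
    apply le_antisymm
    · rintro _ ⟨f, rfl⟩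
      refine ⟨f w, ?_⟩
      change p • f w = f w
      rw [← map_smul, hpw]
    · rintro _ ⟨v, rfl⟩
      refine ⟨(LinearMap.toSpanSingleton R V v) ∘ₗ (Submodule.subtype _) ∘ₗ e.toLinearMap, ?_⟩
      change ((e w : R) : R) • v = (p : A) • v
      rw [LinearEquiv.apply_symm_apply]
      rfl
  refine ⟨FiniteDimensional.of_injective Φ hinj, ?_⟩
  have hidem : IsIdempotentElem (Algebra.lsmul k k V (p : A)) := by
    rw [IsIdempotentElem, ← map_mul (Algebra.lsmul k k V)]
    exact congrArg (Algebra.lsmul k k V) (congrArg Subtype.val hp)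
  rw [character_apply, (LinearMap.isProj_range_iff_isIdempotentElem _).2 hidem |>.trace, ← hrange,
    LinearMap.finrank_range_of_inj hinj]

theorem exists_linearMap_ne_zero {R : Type u} [Ring R] [IsSemisimpleRing R] {κ : Type*}
    {W : κ → Type u} [∀ a, AddCommGroup (W a)] [∀ a, Module R (W a)] (hW : IsSimpleList R W)
    (V : Type u) [AddCommGroup V] [Module R V] [Nontrivial V] :
    ∃ (a : κ) (f : W a →ₗ[R] V), f ≠ 0 := by
  obtain ⟨m, hm⟩ := IsSemisimpleModule.exists_simple_submodule R V
  obtain ⟨a, ⟨e⟩⟩ := hW.complete m hm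
  refine ⟨a, m.subtype ∘ₗ e.symm.toLinearMap, fun h0 => ?_⟩
  have := IsSimpleModule.nontrivial R m
  obtain ⟨x, hx⟩ := exists_ne (0 : m)
  apply hx
  have := LinearMap.congr_fun h0 (e x)
  simpa using this

theorem pivotalFunctional_eq [IsSemisimpleRing A] [IsAlgClosed k] {ι : Type*} [Fintype ι]
    {V : ι → Type u} [∀ j, AddCommGroup (V j)] [∀ j, Module k (V j)] [∀ j, Module A (V j)]
    [∀ j, IsScalarTower k A (V j)] [∀ j, FiniteDimensional k (V j)] (hV : IsSimpleList A V)
    (G : Aˣ) (s : A) :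
    pivotalFunctional k G s = ∑ j, character k (V j) s * character k (V j) (G : A) := by
  rw [pivotalFunctional_apply, trace_mulLeft_mulRight hV]

variable [WeakHopfAlgebra k A]

/-- A pivotal element acts as the identity on some irreducible module (a summand of the unit
object). -/
theorem exists_pivotal_smul_eq [IsSemisimpleRing A] [Nontrivial A] {G : Aˣ}
    (hG : IsPivotalElement k G) (hreg : IsRegular k A) {ι : Type*} {V : ι → Type u}
    [∀ j, AddCommGroup (V j)] [∀ j, Module A (V j)] (hV : IsSimpleList A V) :
    ∃ j, ∀ v : V j, (G : A) • v = v := by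
  -- The quotient of A by ker ε_t is a copy of the unit object A_t.
  let I : Submodule A A :=
    { carrier := {x | targetMap k A x = 0}
      add_mem' := fun {x y} hx hy => by
        change targetMap k A (x + y) = 0
        rw [map_add, show targetMap k A x = 0 from hx, show targetMap k A y = 0 from hy, add_zero]
      zero_mem' := map_zero (targetMap k A)
      smul_mem' := fun c x hx => by
        change targetMap k A (c * x) = 0
        rw [← targetMap_mul_targetMap, show targetMap k A x = 0 from hx, mul_zero, map_zero] }
  -- G commutes with A_t and ε_t(G) = 1, so ε_t(Gx) = ε_t(ε_t(x)G) = ε_t(x).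
  have hI : ∀ x : A, (G : A) * x - x ∈ I := fun x => by
    change targetMap k A ((G : A) * x - x) = 0
    rw [map_sub, ← targetMap_mul_targetMap, pivotal_commute hG (hreg.target (targetMap_mem x)),
      targetMap_target_mul (targetMap_mem x), targetMap_groupLike hG.1, mul_one, sub_self]
  have hG1 : ∀ y : A ⧸ I, (G : A) • y = y := by
    intro y
    obtain ⟨x, rfl⟩ := Submodule.Quotient.mk_surjective I y
    rw [← Submodule.Quotient.mk_smul, Submodule.Quotient.eq]
    exact hI x
  have : Nontrivial (A ⧸ I) := by
    rw [Submodule.Quotient.nontrivial_iff]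
    intro h
    have h1 : (1 : A) ∈ I := h ▸ Submodule.mem_top
    exact one_ne_zero ((targetMap_one (k := k) (A := A)).symm.trans h1)
  obtain ⟨m, hm⟩ := IsSemisimpleModule.exists_simple_submodule A (A ⧸ I)
  obtain ⟨j, ⟨e⟩⟩ := hV.complete m hm
  refine ⟨j, fun v => e.symm.injective ?_⟩
  rw [map_smul]
  exact Subtype.ext (hG1 _)

end Multiplicity

end WeakHopf

/-! ### The main theorem. -/

theorem proposition3 {A : Type u} [Ring A] [Algebra ℂ A] [WeakHopfAlgebra ℂ A]
    (hss : IsSemisimpleRing A)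
    (hreg : WeakHopf.IsRegular ℂ A)
    (hconn : WeakHopf.IsConnected ℂ A)
    (hcoconn : WeakHopf.IsCoconnected ℂ A)
    (G : Aˣ) (hG : WeakHopf.IsPivotalElement ℂ G)
    {n l : ℕ}
    (V : Fin n → Type u) [∀ j, AddCommGroup (V j)] [∀ j, Module ℂ (V j)]
    [∀ j, Module A (V j)] [∀ j, IsScalarTower ℂ A (V j)] [∀ j, FiniteDimensional ℂ (V j)]
    (hV : WeakHopf.IsSimpleList A V)
    (W : Fin l → Type u) [∀ a, AddCommGroup (W a)]
    [∀ a, Module (WeakHopf.sourceBase ℂ A) (W a)]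
    (hW : WeakHopf.IsSimpleList (WeakHopf.sourceBase ℂ A) W) :
    (((WeakHopf.inclusionMatrix ℂ (A := A) V W).map (Nat.cast : ℕ → ℂ)).mulVec
        (fun j => WeakHopf.quantumDim ℂ (V j) G) ≠ 0 →
      WeakHopf.IsTrivialGroupLike ℂ G) ∧
    ((∀ j, ∃ r : ℝ, 0 ≤ r ∧ WeakHopf.quantumDim ℂ (V j) G = (r : ℂ)) →
      WeakHopf.IsTrivialGroupLike ℂ G) := by
  have := WeakHopf.finiteDimensional_of_isSimpleList (k := ℂ) hV
  have := WeakHopf.isSemisimpleRing_sourceBase hG hreg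
  have := hW.simple
  have := hV.simple
  have main : ((WeakHopf.inclusionMatrix ℂ (A := A) V W).map (Nat.cast : ℕ → ℂ)).mulVec
      (fun j => WeakHopf.quantumDim ℂ (V j) G) ≠ 0 → WeakHopf.IsTrivialGroupLike ℂ G := by
    intro h
    obtain ⟨α, hα⟩ := Function.ne_iff.1 h
    obtain ⟨p, hp⟩ := WeakHopf.exists_character_eq_finrank (R := WeakHopf.sourceBase ℂ A) (W α)
    refine WeakHopf.isTrivialGroupLike_of_pivotalFunctional hG hreg hcoconn p.2 fun h0 => hα ?_
    rw [WeakHopf.pivotalFunctional_eq hV] at h0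
    simp only [Matrix.mulVec, dotProduct, Matrix.map_apply, WeakHopf.inclusionMatrix,
      Matrix.of_apply, (hp _).2, WeakHopf.quantumDim_eq hG hreg, Pi.zero_apply, ← mul_div_assoc]
    rw [← Finset.sum_div, h0, zero_div]
  refine ⟨main, fun hd => ?_⟩
  -- The zero algebra has no irreducible modules, so Λd ≠ 0 is unavailable there; G is trivial for
  -- lack of any other element.
  rcases subsingleton_or_nontrivial A with hA | hA
  · exact ⟨1, 1, one_mem _, Subsingleton.elim _ _, Units.ext (Subsingleton.elim _ _)⟩
  apply main
  obtain ⟨j, hj⟩ := WeakHopf.exists_pivotal_smul_eq (k := ℂ) hG hreg hV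
  have := IsSimpleModule.nontrivial A (V j)
  obtain ⟨α, f, hf⟩ := WeakHopf.exists_linearMap_ne_zero hW (V j)
  obtain ⟨p, hp⟩ := WeakHopf.exists_character_eq_finrank (R := WeakHopf.sourceBase ℂ A) (W α)
  choose r hr0 hr using hd
  -- Since G acts on Vⱼ as the identity, the quantum dimension is the ordinary dimension of Vⱼ
  -- divided by that of A_t.
  have hrj : r j ≠ 0 := by
    intro h0
    have h1 := hr j
    have h2 : Algebra.lsmul ℂ ℂ (V j) (G : A) = LinearMap.id := LinearMap.ext hj
    rw [WeakHopf.quantumDim_eq hG hreg, WeakHopf.character_apply, h2, LinearMap.trace_id, h0] at h1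
    have h3 : Module.finrank ℂ (V j) ≠ 0 := Module.finrank_pos.ne'
    have h4 : Module.finrank ℂ (WeakHopf.targetBase ℂ A) ≠ 0 := Module.finrank_pos.ne'
    simp [h3, h4] at h1
  have hΛ : WeakHopf.inclusionMatrix ℂ (A := A) V W α j ≠ 0 := by
    have := (hp (V j)).1
    have : Nontrivial (W α →ₗ[WeakHopf.sourceBase ℂ A] V j) := ⟨f, 0, hf⟩
    exact Module.finrank_pos.ne'
  intro h0
  have h1 := congrFun h0 α
  simp only [Matrix.mulVec, dotProduct, Matrix.map_apply, hr, Pi.zero_apply] at h1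
  -- A vanishing sum of non-negative reals has all terms zero, against the nonzero term at j.
  have h2 : ∑ i, (WeakHopf.inclusionMatrix ℂ (A := A) V W α i : ℝ) * r i = 0 := by
    exact_mod_cast h1
  rw [Finset.sum_eq_zero_iff_of_nonneg fun i _ => mul_nonneg (Nat.cast_nonneg _) (hr0 i)] at h2
  exact (mul_ne_zero (Nat.cast_ne_zero.2 hΛ) hrj) (h2 j (Finset.mem_univ j))
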